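/- Let $d\ge 1$. An ensemble on $\mathbb{C}^d$ is a measurable function $x\mapsto\rho_x$ from $\mathbb{R}$ to positive semidefinite operators with $\operatorname{Tr}\rho_x\le 1$ such that $\int_{\mathbb R}\operatorname{Tr}[\rho_x]\,dx=1$; a POVM is a measurable function $y\mapsto\pi_y$ from $\mathbb{R}$ to operators with $0\le\pi_y\le \mathbb 1$ such that $\int_{\mathbb R}\pi_y\,dy=\mathbb 1$. For an ensemble $\rho$ and a POVM $\pi$, let $I(\rho,\pi)$ be the mutual information (relative entropy, with natural logarithm, of the joint law with respect to the product of its marginals) of the pair $(X,Y)$ with joint density $p(x,y)=\operatorname{Tr}[\rho_x\pi_y]$. The informational power of $\pi$ is $W(\pi)=\sup_{\rho} I(\rho,\pi)$ over all ensembles, and the accessible information of $\rho$ is $A(\rho)=\sup_{\pi} I(\rho,\pi)$ over all POVMs. An ensemble $\rho$ is a $t$-design if, for every $1\le k\le t$, $$\int_{\mathbb R}\frac{\rho_x^{\otimes k}}{\operatorname{Tr}[\rho_x]^{k-1}}\,dx=\int |\psi\rangle\langle\psi|^{\otimes k}\,d\sigma(\psi),$$ where $\sigma$ is the uniform probability measure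 on the unit sphere of $\mathbb{C}^d$ (the left integrand is $0$ where $\rho_x=0$); a POVM $\pi$ is a $t$-design if this condition holds for $\rho_x=\pi_x/d$. Theorem. Let $t\ge1$, let $0<x_1<\dots<x_{\lfloor t/2\rfloor}<1$ be any nodes, and let $\eta(x)=-x\ln x$. There is exactly one real polynomial of the form $p(x)=\sum_{k=1}^t a_kx^k$ such that $p(x_i)=\eta(x_i)$ and $p'(x_i)=\eta'(x_i)$ for all $1\le i\le\lfloor t/2\rfloor$ and, if $t$ is odd, $p(1)=0$. With its coefficients $a_k$, every $t$-design POVM $\pi$ on $\mathbb{C}^d$ satisfies $$W(\pi)\le \ln d-d\sum_{k=1}^t a_k\binom{d+k-1}{k}^{-1},$$ and every $t$-design ensemble $\rho$ on $\mathbb{C}^d$ satisfies $$A(\rho)\le \ln d-d\sum_{k=1}^t a_k\binom{d+k-1}{k}^{-1}.$$ -/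

import Mathlib

open MeasureTheory
open scoped ENNReal ComplexOrder

noncomputable section

/-- An ensemble on a `d`-dimensional Hilbert space: a measurable function from the reals to
states (positive semidefinite operators of trace at most one) of total trace one with respect to
Lebesgue measure. Operators are written as matrices in an orthonormal basis. -/
structure Ensemble (d : ℕ) where
  state : ℝ → Matrix (Fin d) (Fin d) ℂ
  measurable_entry : ∀ i j, Measurable fun x => state x i j
  posSemidef : ∀ x, (state x).PosSemidef
  trace_le_one : ∀ x, (state x).trace.re ≤ 1
  integral_trace : ∫ x, (state x).trace.re = 1

/-- A positive-operator valued measure (POVM) on a `d`-dimensional Hilbert space: a measurable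
function from the reals to effects (operators between `0` and the identity) which integrates
(entrywise, with respect to Lebesgue measure) to the identity. -/
structure POVM (d : ℕ) where
  effect : ℝ → Matrix (Fin d) (Fin d) ℂ
  measurable_entry : ∀ i j, Measurable fun y => effect y i j
  posSemidef : ∀ y, (effect y).PosSemidef
  le_one : ∀ y, (1 - effect y).PosSemidef
  integrable_entry : ∀ i j, Integrable fun y => effect y i j
  integral_effect : ∀ i j, ∫ y, effect y i j = (1 : Matrix (Fin d) (Fin d) ℂ) i j

/-- The `k`-th tensor power of an operator, as a matrix in the product basis. -/
def tensorPower {d : ℕ} (k : ℕ) (A : Matrix (Fin d) (Fin d) ℂ) :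
    Matrix (Fin k → Fin d) (Fin k → Fin d) ℂ :=
  Matrix.of fun i j => ∏ s, A (i s) (j s)

/-- The uniform (unitarily invariant) probability measure on the unit sphere of `ℂ^d`: the
normalized surface measure. -/
def uniformSphere (d : ℕ) : Measure (Metric.sphere (0 : EuclideanSpace ℂ (Fin d)) 1) :=
  ((volume : Measure (EuclideanSpace ℂ (Fin d))).toSphere Set.univ)⁻¹ •
    (volume : Measure (EuclideanSpace ℂ (Fin d))).toSphere

/-- The pure state `|ψ⟩⟨ψ|`. -/
def pureState {d : ℕ} (ψ : EuclideanSpace ℂ (Fin d)) : Matrix (Fin d) (Fin d) ℂ :=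
  Matrix.of fun i j => ψ i * star (ψ j)

/-- The spherical `t`-design condition on an operator-valued function: for every `1 ≤ k ≤ t`, the
integral of `ρ_x^{⊗k} / Tr[ρ_x]^{k-1}` is equal (entrywise) to the same integral for the ensemble
of pure states distributed uniformly on the unit sphere, for which `Tr[ψ] = ‖ψ‖² = 1`.
Where `ρ_x = 0` the integrand is `0`. -/
def IsSphericalDesign {d : ℕ} (t : ℕ) (ρ : ℝ → Matrix (Fin d) (Fin d) ℂ) : Prop :=
  ∀ k, 1 ≤ k → k ≤ t → ∀ i j : Fin k → Fin d,
    ∫ x, tensorPower k (ρ x) i j / (ρ x).trace ^ (k - 1) =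
      ∫ ψ, tensorPower k (pureState (ψ : EuclideanSpace ℂ (Fin d))) i j ∂(uniformSphere d)

/-- A `t`-design ensemble. -/
def Ensemble.IsDesign {d : ℕ} (t : ℕ) (ρ : Ensemble d) : Prop :=
  IsSphericalDesign t ρ.state

/-- A `t`-design POVM: the ensemble `π_y / d` is a `t`-design. -/
def POVM.IsDesign {d : ℕ} (t : ℕ) (π : POVM d) : Prop :=
  IsSphericalDesign t fun y => ((d : ℂ)⁻¹) • π.effect y

/-- The joint law of input and outcome, with density `Tr[ρ_x π_y]` (Born rule). -/
def jointLaw {d : ℕ} (ρ : Ensemble d) (π : POVM d) : Measure (ℝ × ℝ) :=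
  (volume : Measure (ℝ × ℝ)).withDensity fun z =>
    ENNReal.ofReal (ρ.state z.1 * π.effect z.2).trace.re

/-- The mutual information (in nats): the relative entropy between the joint law and the product
of its marginals. -/
def mutualInformation {d : ℕ} (ρ : Ensemble d) (π : POVM d) : ℝ≥0∞ :=
  InformationTheory.klDiv (jointLaw ρ π) ((jointLaw ρ π).fst.prod (jointLaw ρ π).snd)

/-- The informational power `W` of a POVM. -/
def POVM.informationalPower {d : ℕ} (π : POVM d) : ℝ≥0∞ :=
  ⨆ ρ : Ensemble d, mutualInformation ρ π

/-- The accessible information `A` of an ensemble. -/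
def Ensemble.accessibleInformation {d : ℕ} (ρ : Ensemble d) : ℝ≥0∞ :=
  ⨆ π : POVM d, mutualInformation ρ π

/-- `p` is of the form `∑_{k=1}^t a_k X^k`, vanishes at `1` when `t` is odd, and agrees with
`η(x) = -x ln x` to first order at each of the nodes. -/
structure IsEtaInterpolant (t : ℕ) (x : Fin (t / 2) → ℝ) (p : Polynomial ℝ) : Prop where
  natDegree_le : p.natDegree ≤ t
  coeff_zero : p.coeff 0 = 0
  eval_one : Odd t → p.eval 1 = 0
  eval_node : ∀ i, p.eval (x i) = Real.negMulLog (x i)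
  deriv_node : ∀ i, p.derivative.eval (x i) = deriv Real.negMulLog (x i)

end

/-! Let `Q` be the outcome law of `π` for the maximally mixed input. Replacing the true outcome
marginal by `Q` can only increase the relative entropy, and the joint law has density `d * s` with
respect to (input law) × `Q`, where `s`, the overlap of the normalized state with the normalized
effect, lies in `[0, 1]`. Hence `I ≤ ln d - d ∫ η(s)`, and an average of `η` must be bounded from
below (`mutualInformation_le`).

Fix the normalized operator on the non-design side and split it into pure states. Concavity of `η`
moves the average onto the pure states, and `p ≤ η` on `[0, 1]` replaces `η` by a polynomial of
degree at most `t` without constant term. The design condition then evaluates each power: the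
average of the `k`-th power of the overlap with a unit vector is its Haar average `1 / binom(d+k-1,
k)`, computed from a Gaussian integral. States and effects enter `s` symmetrically, so one estimate,
`IsSphericalDesign.sum_coeff_le_integral_negMulLog`, serves both `W` and `A`.

That `p ≤ η` is the error formula for Hermite interpolation. With `q = p / x`, the error `-log - q`
at a point is `c * w`, where `w` is the product of the squared node factors, times `x - 1` for odd
`t`. Rolle's theorem gives `c` the sign `(-1) ^ t`, which is also the sign of `w` on `[0, 1]` away
from its zeros. -/

/-! ### Hermite interpolation of `η` -/

open Polynomial in
/-- A polynomial of degree at most `t` with double zeros at the nodes, a zero at `0`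
and, for odd `t`, a zero at `1`, vanishes. -/
theorem eq_zero_of_hermite_data_eq_zero {t : ℕ} {x : Fin (t / 2) → ℝ} (hx : StrictMono x)
    (hx01 : ∀ i, 0 < x i ∧ x i < 1) {p : ℝ[X]} (hdeg : p.natDegree ≤ t) (h0 : p.eval 0 = 0)
    (h1 : Odd t → p.eval 1 = 0) (hn : ∀ i, p.eval (x i) = 0)
    (hd : ∀ i, p.derivative.eval (x i) = 0) : p = 0 := by
  by_contra hp
  set N : Finset ℝ := Finset.univ.image x with hN
  set E : Finset ℝ := if Odd t then {1} else ∅ with hE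
  have h0N : (0 : ℝ) ∉ N ∪ E := by
    simp only [hN, hE, Finset.mem_union, Finset.mem_image, Finset.mem_univ, true_and, not_or,
      not_exists]
    refine ⟨fun i => (hx01 i).1.ne', ?_⟩
    split_ifs <;> simp
  have hdisj : Disjoint N E := by
    rw [Finset.disjoint_left]
    intro a ha
    simp only [hN, Finset.mem_image, Finset.mem_univ, true_and] at ha
    obtain ⟨i, rfl⟩ := ha
    simp only [hE]
    split_ifs
    · simpa using (hx01 i).2.ne
    · simp
  have hle : ∑ a ∈ insert 0 (N ∪ E), p.rootMultiplicity a ≤ p.natDegree := by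
    refine le_trans ?_ p.card_roots'
    rw [← Multiset.toFinset_sum_count_eq]
    simp only [count_roots]
    refine Finset.sum_le_sum_of_ne_zero fun a _ ha => ?_
    rw [Multiset.mem_toFinset, mem_roots hp]
    by_contra hr
    exact ha (rootMultiplicity_eq_zero hr)
  rw [Finset.sum_insert h0N, Finset.sum_union hdisj, hN,
    Finset.sum_image (fun i _ j _ h => hx.injective h)] at hle
  have hz : 1 ≤ p.rootMultiplicity 0 := (rootMultiplicity_pos hp).2 h0
  have hs : (t / 2) * 2 ≤ ∑ i, p.rootMultiplicity (x i) := by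
    have : ∑ _i : Fin (t / 2), 2 ≤ ∑ i, p.rootMultiplicity (x i) :=
      Finset.sum_le_sum fun i _ => (one_lt_rootMultiplicity_iff_isRoot hp).2 ⟨hn i, hd i⟩
    simpa using this
  have ho : t % 2 ≤ ∑ a ∈ E, p.rootMultiplicity a := by
    rcases Nat.even_or_odd t with h | h
    · simp [Nat.even_iff.1 h]
    · simp only [hE, if_pos h, Finset.sum_singleton, Nat.odd_iff.1 h]
      exact (rootMultiplicity_pos hp).2 (h1 h)
  -- Counted with multiplicity there are at least `1 + 2 * (t / 2) + t % 2 = t + 1` zeros, more than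
  -- the degree allows.
  omega

open Polynomial in
/-- The Hermite interpolation problem defining `IsEtaInterpolant` is uniquely solvable. -/
theorem existsUnique_isEtaInterpolant {t : ℕ} {x : Fin (t / 2) → ℝ} (hx : StrictMono x)
    (hx01 : ∀ i, 0 < x i ∧ x i < 1) : ∃! p : ℝ[X], IsEtaInterpolant t x p := by
  -- Both sides have dimension `t + 1`, so injectivity gives existence. The factor indexed by `Fin
  -- (t % 2)` is the condition at `1`; it is void for even `t`.
  let Φ : degreeLT ℝ (t + 1) →ₗ[ℝ]
      ℝ × (Fin (t / 2) → ℝ) × (Fin (t / 2) → ℝ) × (Fin (t % 2) → ℝ) :=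
    ((leval 0).prod ((LinearMap.pi fun i => leval (x i)).prod
      ((LinearMap.pi fun i => (leval (x i)).comp derivative).prod
        (LinearMap.pi fun _ => leval 1)))).comp (degreeLT ℝ (t + 1)).subtype
  have hdeg : ∀ p : ℝ[X], p ∈ degreeLT ℝ (t + 1) ↔ p.natDegree ≤ t := by
    intro p
    rw [mem_degreeLT, degree_lt_iff_coeff_zero, natDegree_le_iff_coeff_eq_zero]
    rfl
  have hinj : Function.Injective Φ := by
    rw [← LinearMap.ker_eq_bot, LinearMap.ker_eq_bot']
    rintro ⟨p, hp⟩ h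
    simp only [Φ, LinearMap.comp_apply, Submodule.subtype_apply, LinearMap.prod_apply,
      Function.prod_apply, Prod.mk_eq_zero, funext_iff, LinearMap.pi_apply, Pi.zero_apply,
      leval_apply] at h
    obtain ⟨h0, hn, hd, h1⟩ := h
    refine Subtype.ext (eq_zero_of_hermite_data_eq_zero hx hx01 ((hdeg p).1 hp) h0 (fun ho => ?_)
      hn hd)
    exact h1 ⟨0, by rw [Nat.odd_iff.1 ho]; exact one_pos⟩
  have hrank : Module.finrank ℝ (degreeLT ℝ (t + 1)) = Module.finrank ℝ
      (ℝ × (Fin (t / 2) → ℝ) × (Fin (t / 2) → ℝ) × (Fin (t % 2) → ℝ)) := by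
    rw [(degreeLTEquiv ℝ (t + 1)).finrank_eq]
    simp only [Module.finrank_prod, Module.finrank_fin_fun, Module.finrank_self]
    omega
  have : FiniteDimensional ℝ (degreeLT ℝ (t + 1)) :=
    Module.Finite.equiv (degreeLTEquiv ℝ (t + 1)).symm
  obtain ⟨⟨p, hp⟩, hpe⟩ := (LinearMap.injective_iff_surjective_of_finrank_eq_finrank hrank).1 hinj
    (0, fun i => Real.negMulLog (x i), fun i => deriv Real.negMulLog (x i), 0)
  simp only [Φ, LinearMap.comp_apply, Submodule.subtype_apply, LinearMap.prod_apply,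
    Function.prod_apply, Prod.mk.injEq, funext_iff, LinearMap.pi_apply, Pi.zero_apply,
    leval_apply] at hpe
  obtain ⟨h0, hn, hd, h1⟩ := hpe
  refine ⟨p, ⟨(hdeg p).1 hp, by rw [coeff_zero_eq_eval_zero, h0], fun ho =>
    h1 ⟨0, by rw [Nat.odd_iff.1 ho]; exact one_pos⟩, hn, hd⟩, fun q hq => ?_⟩
  rw [← sub_eq_zero]
  refine eq_zero_of_hermite_data_eq_zero hx hx01 ?_ ?_ ?_ ?_ ?_
  · exact (natDegree_sub_le _ _).trans (max_le hq.natDegree_le ((hdeg p).1 hp))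
  · rw [eval_sub, h0, ← coeff_zero_eq_eval_zero, hq.coeff_zero, sub_zero]
  · intro ho
    rw [eval_sub, hq.eval_one ho, h1 ⟨0, by rw [Nat.odd_iff.1 ho]; exact one_pos⟩, sub_zero]
  · intro i
    rw [eval_sub, hq.eval_node, hn, sub_self]
  · intro i
    rw [derivative_sub, eval_sub, hq.deriv_node]
    simpa using sub_eq_zero.2 (hd i).symm

open Polynomial in
/-- Sign of the leading coefficient in the error formula for Hermite interpolation of `-log`: if
`w` is monic of degree `t > deg q` and `-log - q - c * w` has `t + 1` positive zeros in total,
those in `S` counted once and those in `D ⊆ S` once more as double zeros,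
then `(-1) ^ t * c > 0`. -/
theorem neg_one_pow_mul_pos_of_zeros {t : ℕ} (ht : 1 ≤ t) {q w : ℝ[X]} {c : ℝ}
    (hq : q.natDegree < t) (hw : w.natDegree = t) {S D : Finset ℝ} (hDS : D ⊆ S)
    (hS : ∀ a ∈ S, 0 < a) (hcard : S.card + D.card = t + 1) (hw1 : w.Monic)
    (hz : ∀ a ∈ S, -Real.log a - q.eval a - c * w.eval a = 0)
    (hd : ∀ a ∈ D, -a⁻¹ - q.derivative.eval a - c * w.derivative.eval a = 0) :
    0 < (-1) ^ t * c := by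
  -- `-X` times the derivative of `-log - q - c * w`: a polynomial whose positive roots are the
  -- positive critical points of the error, with constant term `1` and top coefficient `c * t`.
  set R : ℝ[X] := 1 + X * (q.derivative + C c * w.derivative) with hR
  have hRe : ∀ a : ℝ, 0 < a → (R.eval a = 0 ↔
      -a⁻¹ - q.derivative.eval a - c * w.derivative.eval a = 0) := by
    intro a ha
    have : R.eval a = -a * (-a⁻¹ - q.derivative.eval a - c * w.derivative.eval a) := by
      simp [hR]; field_simp; ring
    rw [this, mul_eq_zero, or_iff_right (neg_ne_zero.2 ha.ne')]
  have hR0 : R.eval 0 = 1 := by simp [hR]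
  have hRne : R ≠ 0 := by rintro h; simp [h] at hR0
  have hRdeg : R.natDegree ≤ t := by
    refine (natDegree_add_le _ _).trans (max_le (by simp) ?_)
    refine (natDegree_mul_le).trans ?_
    rw [natDegree_X]
    have : (q.derivative + C c * w.derivative).natDegree ≤ t - 1 := by
      refine (natDegree_add_le _ _).trans (max_le ?_ ?_)
      · exact (natDegree_derivative_le q).trans (by omega)
      · exact (natDegree_C_mul_le _ _).trans ((natDegree_derivative_le w).trans (by omega))
    omega
  have hRc : R.coeff t = c * t := by
    obtain ⟨m, rfl⟩ : ∃ m, t = m + 1 := ⟨t - 1, by omega⟩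
    have h1 : q.coeff (m + 1) = 0 := coeff_eq_zero_of_natDegree_lt hq
    have h2 : w.coeff (m + 1) = 1 := by rw [← hw]; exact hw1
    simp [hR, coeff_X_mul, coeff_derivative, h1, h2, coeff_one]
  set T : Finset ℝ := R.roots.toFinset.filter (0 < ·) with hT
  -- Rolle between consecutive zeros gives `S.card - 1` critical points outside `S`; the double
  -- zeros `D ⊆ S` are further ones, for a total of at least `t`.
  have hTS : S.card ≤ (T \ S).card + 1 := by
    refine Finset.card_le_sdiff_of_interleaved fun a ha b hb hab _ => ?_
    have hpos : ∀ z ∈ Set.Icc a b, z ≠ 0 := fun z hz => ((hS a ha).trans_le hz.1).ne'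
    obtain ⟨z, hz, hz'⟩ := exists_hasDerivAt_eq_zero
      (f := fun z => -Real.log z - q.eval z - c * w.eval z)
      (f' := fun z => -z⁻¹ - q.derivative.eval z - c * w.derivative.eval z) hab
      (by
        refine ContinuousOn.sub (ContinuousOn.sub ?_ q.continuous.continuousOn)
          (continuous_const.mul w.continuous).continuousOn
        exact (Real.continuousOn_log.mono fun z hz => hpos z hz).neg)
      (by rw [hz a ha, hz b hb])
      (fun z hz => ((Real.hasDerivAt_log (hpos z (Set.Ioo_subset_Icc_self hz))).neg.sub
        (q.hasDerivAt z)).sub ((w.hasDerivAt z).const_mul c))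
    have hz0 : 0 < z := (hS a ha).trans hz.1
    refine ⟨z, ?_, hz.1, hz.2⟩
    rw [hT, Finset.mem_filter, Multiset.mem_toFinset, mem_roots hRne]
    exact ⟨(hRe z hz0).2 hz', hz0⟩
  have hDT : D ⊆ T := fun a ha => by
    rw [hT, Finset.mem_filter, Multiset.mem_toFinset, mem_roots hRne]
    exact ⟨(hRe a (hS a (hDS ha))).2 (hd a ha), hS a (hDS ha)⟩
  have hTcard : t ≤ T.card := by
    have h1 : (T \ S).card + D.card ≤ T.card := by
      rw [← Finset.card_union_of_disjoint]
      · exact Finset.card_le_card (Finset.union_subset Finset.sdiff_subset hDT)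
      · exact Finset.disjoint_left.2 fun a ha hb => (Finset.mem_sdiff.1 ha).2 (hDS hb)
    omega
  have hTle : T.val ≤ R.roots :=
    (Multiset.le_iff_subset T.nodup).2 fun a ha =>
      Multiset.mem_toFinset.1 (Finset.mem_filter.1 ha).1
  have hcr : R.roots.card = R.natDegree ∧ R.natDegree = t := by
    have h1 := R.card_roots'
    have h2 := Multiset.card_le_card hTle
    rw [Finset.card_val] at h2
    omega
  have hTr : T.val = R.roots := Multiset.eq_of_le_of_card_le hTle (by
    rw [Finset.card_val]; omega)
  have hfac := C_leadingCoeff_mul_prod_multiset_X_sub_C hcr.1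
  rw [← hTr, leadingCoeff, hcr.2, hRc] at hfac
  -- All `t` roots of `R` are thus positive and simple. Comparing the constant terms of `R` and its
  -- factorization fixes the sign of `c`.
  have hev : (c * t) * ∏ a ∈ T, (-a) = 1 := by
    rw [← hR0, ← hfac, eval_mul, eval_C]
    congr 1
    have : (Multiset.map (fun a => X - C a) T.val).prod = ∏ a ∈ T, (X - C a) := rfl
    rw [this, eval_prod]
    simp
  have hTt : T.card = t := by rw [← Finset.card_val, hTr]; omega
  rw [Finset.prod_neg, hTt] at hev
  have hpp : 0 < t * ∏ a ∈ T, a :=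
    mul_pos (by exact_mod_cast ht) (Finset.prod_pos fun a ha => (Finset.mem_filter.1 ha).2)
  have : (-1) ^ t * c * (t * ∏ a ∈ T, a) = 1 := by linear_combination hev
  exact pos_of_mul_pos_left (by rw [this]; exact one_pos) hpp.le

open Polynomial in
/-- The interpolant lies below `η` on the unit interval. -/
theorem IsEtaInterpolant.eval_le_negMulLog {t : ℕ} (ht : 1 ≤ t) {x : Fin (t / 2) → ℝ}
    (hx : StrictMono x) (hx01 : ∀ i, 0 < x i ∧ x i < 1) {p : ℝ[X]} (hp : IsEtaInterpolant t x p)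
    {y : ℝ} (hy0 : 0 ≤ y) (hy1 : y ≤ 1) : p.eval y ≤ Real.negMulLog y := by
  set N : Finset ℝ := Finset.univ.image x with hN
  set E : Finset ℝ := if Odd t then {1} else ∅ with hE
  have hNmem : ∀ a, a ∈ N ↔ ∃ i, x i = a := by simp [hN]
  have hEmem : ∀ a, a ∈ E ↔ Odd t ∧ a = 1 := by
    intro a; simp only [hE]; split_ifs with h <;> simp [h]
  -- Dividing by `X` uses up the zero at `0` and turns the comparison with `η` into one of `q` with
  -- `-log`.
  have hpX : p = X * p.divX := by
    conv_lhs => rw [← X_mul_divX_add p, hp.coeff_zero, C_0, add_zero]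
  set q := p.divX with hq
  have hpe : ∀ a, p.eval a = a * q.eval a := fun a => by rw [hpX]; simp
  have hpd : ∀ a, p.derivative.eval a = q.eval a + a * q.derivative.eval a := fun a => by
    rw [hpX]; simp
  have hqN : ∀ a ∈ N, -Real.log a - q.eval a = 0 ∧ -a⁻¹ - q.derivative.eval a = 0 := by
    intro a ha
    obtain ⟨i, rfl⟩ := (hNmem a).1 ha
    have h0 := (hx01 i).1.ne'
    have h1 := hp.eval_node i
    have h2 := hp.deriv_node i
    rw [hpe, Real.negMulLog] at h1
    rw [hpd, Real.deriv_negMulLog h0] at h2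
    have h3 : q.eval (x i) = -Real.log (x i) := by
      apply mul_left_cancel₀ h0; rw [h1]; ring
    refine ⟨by rw [h3]; ring, ?_⟩
    rw [h3] at h2
    apply mul_left_cancel₀ h0
    rw [mul_sub, mul_neg, mul_inv_cancel₀ h0]
    linarith
  have hqE : ∀ a ∈ E, -Real.log a - q.eval a = 0 := by
    intro a ha
    obtain ⟨ho, rfl⟩ := (hEmem a).1 ha
    have := hp.eval_one ho
    rw [hpe, one_mul] at this
    simp [this]
  have hlog : Real.negMulLog y - p.eval y = y * (-Real.log y - q.eval y) := by
    rw [hpe, Real.negMulLog]; ring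
  rw [← sub_nonneg, hlog]
  by_cases hyz : y = 0
  · simp [hyz]
  have hy0 : 0 < y := lt_of_le_of_ne hy0 (Ne.symm hyz)
  refine mul_nonneg hy0.le ?_
  by_cases hyN : y ∈ N
  · rw [(hqN y hyN).1]
  by_cases hyE : y ∈ E
  · rw [hqE y hyE]
  have hNE : Disjoint N E := by
    rw [Finset.disjoint_left]
    intro a ha hb
    obtain ⟨i, rfl⟩ := (hNmem a).1 ha
    exact (hx01 i).2.ne ((hEmem _).1 hb).2
  have hNcard : N.card = t / 2 := by
    rw [hN, Finset.card_image_of_injective _ hx.injective]; simp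
  have hEcard : E.card = t % 2 := by
    rcases Nat.even_or_odd t with h | h
    · simp [hE, Nat.not_odd_iff_even.2 h, Nat.even_iff.1 h]
    · simp [hE, h, Nat.odd_iff.1 h]
  set w : ℝ[X] := (∏ a ∈ N, (X - C a)) ^ 2 * ∏ a ∈ E, (X - C a) with hw
  have hm : ∀ s : Finset ℝ, (∏ a ∈ s, (X - C a)).Monic := fun s =>
    monic_prod_of_monic _ _ fun a _ => monic_X_sub_C a
  have hwm : w.Monic := ((hm N).pow 2).mul (hm E)
  have hdegprod : ∀ s : Finset ℝ, (∏ a ∈ s, (X - C a)).natDegree = s.card := fun s => by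
    rw [natDegree_prod_of_monic _ _ fun a _ => monic_X_sub_C a]; simp
  have hwdeg : w.natDegree = t := by
    rw [hw, ((hm N).pow 2).natDegree_mul (hm E), (hm N).natDegree_pow, hdegprod, hdegprod, hNcard,
      hEcard]
    omega
  have hwe : ∀ b, w.eval b = (∏ a ∈ N, (b - a)) ^ 2 * ∏ a ∈ E, (b - a) := fun b => by
    simp [hw, eval_prod]
  have hwy : w.eval y ≠ 0 := by
    rw [hwe]
    refine mul_ne_zero (pow_ne_zero _ (Finset.prod_ne_zero_iff.2 fun a ha => ?_))
      (Finset.prod_ne_zero_iff.2 fun a ha => ?_)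
    · exact sub_ne_zero.2 fun h => hyN (h ▸ ha)
    · exact sub_ne_zero.2 fun h => hyE (h ▸ ha)
  -- This choice makes `-log - q - c * w` vanish at `y` as well, the one zero needed beyond the `t`
  -- interpolation conditions.
  set c := (-Real.log y - q.eval y) / w.eval y with hc
  have hcw : -Real.log y - q.eval y = c * w.eval y := by rw [hc, div_mul_cancel₀ _ hwy]
  have hyNE : y ∉ N ∪ E := by simp [hyN, hyE]
  have hqdeg : q.natDegree < t := by
    rw [hq, natDegree_divX_eq_natDegree_tsub_one]; have := hp.natDegree_le; omega
  have hsign := neg_one_pow_mul_pos_of_zeros ht (c := c) hqdeg hwdeg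
    (S := insert y (N ∪ E)) (D := N) (Finset.subset_union_left.trans (Finset.subset_insert _ _))
    (by
      intro a ha
      simp only [Finset.mem_insert, Finset.mem_union] at ha
      rcases ha with rfl | ha | ha
      · exact hy0
      · obtain ⟨i, rfl⟩ := (hNmem a).1 ha
        exact (hx01 i).1
      · rw [((hEmem a).1 ha).2]; exact one_pos)
    (by rw [Finset.card_insert_of_notMem hyNE, Finset.card_union_of_disjoint hNE, hNcard, hEcard]
        omega) hwm
    (by
      intro a ha
      simp only [Finset.mem_insert, Finset.mem_union] at ha
      rcases ha with rfl | ha | ha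
      · rw [hcw, sub_self]
      · rw [(hqN a ha).1, hwe, Finset.prod_eq_zero ha (sub_self a)]; ring
      · rw [hqE a ha, hwe, Finset.prod_eq_zero ha (sub_self a)]; ring)
    (by
      intro a ha
      have : w.derivative.eval a = 0 := by
        have h0 : (∏ b ∈ N, (X - C b) : ℝ[X]).eval a = 0 := by
          rw [eval_prod]; exact Finset.prod_eq_zero ha (by simp)
        rw [hw, derivative_mul, derivative_pow]
        simp [h0]
      rw [(hqN a ha).2, this]; ring)
  rw [hcw, hwe]
  rcases Nat.even_or_odd t with h | h
  · rw [h.neg_one_pow, one_mul] at hsign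
    have : E = ∅ := by simp [hE, Nat.not_odd_iff_even.2 h]
    rw [this, Finset.prod_empty, mul_one]
    positivity
  · rw [h.neg_one_pow] at hsign
    have : E = {1} := by simp [hE, h]
    rw [this, Finset.prod_singleton]
    have h1 : 0 ≤ (∏ a ∈ N, (y - a)) ^ 2 := sq_nonneg _
    have h2 : 0 ≤ -c * (1 - y) := mul_nonneg (by linarith) (by linarith)
    nlinarith [mul_nonneg h1 h2]

/-! ### Moments of overlaps on the unit sphere -/

open Metric in
/-- Integration in polar coordinates of a function that separates into an angular and a radial
factor. -/
theorem integral_eq_integral_toSphere_mul {E : Type*} [NormedAddCommGroup E] [NormedSpace ℝ E]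
    [MeasurableSpace E] [BorelSpace E] [FiniteDimensional ℝ E] [Nontrivial E] (μ : Measure E)
    [μ.IsAddHaarMeasure] {f g : E → ℝ} {h : ℝ → ℝ}
    (hf : ∀ u : sphere (0 : E) 1, ∀ r : ℝ, 0 < r → f (r • (u : E)) = g u * h r) :
    ∫ x, f x ∂μ = (∫ u : sphere (0 : E) 1, g u ∂μ.toSphere) *
      ∫ r in Set.Ioi (0 : ℝ), r ^ (Module.finrank ℝ E - 1) * h r := by
  calc
    ∫ x, f x ∂μ = ∫ x : ({(0)}ᶜ : Set E), f x ∂(μ.comap (↑)) := by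
      rw [integral_subtype_comap (measurableSet_singleton _).compl f,
        restrict_compl_singleton]
    _ = ∫ z : sphere (0 : E) 1 × Set.Ioi (0 : ℝ), g z.1 * h z.2
        ∂μ.toSphere.prod (.volumeIoiPow (Module.finrank ℝ E - 1)) := by
      rw [← μ.measurePreserving_homeomorphUnitSphereProd.symm
        (homeomorphUnitSphereProd E).toMeasurableEquiv |>.integral_comp
        (MeasurableEquiv.measurableEmbedding _)]
      refine integral_congr_ae (.of_forall fun z => ?_)
      exact hf z.1 z.2 z.2.2
    _ = (∫ u : sphere (0 : E) 1, g u ∂μ.toSphere) *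
        ∫ r : Set.Ioi (0 : ℝ), h r ∂.volumeIoiPow (Module.finrank ℝ E - 1) :=
      integral_prod_mul (fun u : sphere (0 : E) 1 => g u) fun r : Set.Ioi (0 : ℝ) => h r
    _ = _ := by
      congr 1
      simp only [Measure.volumeIoiPow, ENNReal.ofReal]
      rw [integral_withDensity_eq_integral_smul,
        integral_subtype_comap measurableSet_Ioi
          fun a ↦ Real.toNNReal (a ^ (Module.finrank ℝ E - 1)) • h a,
        setIntegral_congr_fun measurableSet_Ioi fun x hx ↦ ?_]
      · rw [NNReal.smul_def, Real.coe_toNNReal _ (pow_nonneg hx.out.le _), smul_eq_mul]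
      · exact (measurable_subtype_coe.pow_const _).real_toNNReal

theorem integral_norm_pow_mul_exp_neg_sq_complex (k : ℕ) :
    ∫ z : ℂ, ‖z‖ ^ (2 * k) * Real.exp (-‖z‖ ^ 2) = Real.pi * k.factorial := by
  have h := Complex.integral_rpow_mul_exp_neg_rpow (p := 2) (q := (2 * k : ℕ)) (by norm_num)
    (by have : (0 : ℝ) ≤ (2 * k : ℕ) := Nat.cast_nonneg _
        linarith)
  have h2 : ((2 * k : ℕ) + 2 : ℝ) / 2 = k + 1 := by push_cast; ring
  rw [h2, Real.Gamma_nat_eq_factorial] at h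
  simp only [Real.rpow_natCast, Real.rpow_ofNat] at h
  rw [h]; ring

/-- The radial factor of a Gaussian moment: `r ^ (2 * m - 1)` is the polar Jacobian in complex
dimension `m`. -/
theorem integral_pow_mul_exp_neg_sq_Ioi (m k : ℕ) (hm : 1 ≤ m) :
    ∫ r in Set.Ioi (0 : ℝ), r ^ (2 * m - 1) * (r ^ (2 * k) * Real.exp (-r ^ 2)) =
      (m + k - 1).factorial / 2 := by
  have h := integral_rpow_mul_exp_neg_rpow (p := 2) (q := (2 * m - 1 + 2 * k : ℕ)) (by norm_num)
    (by have : (0 : ℝ) ≤ (2 * m - 1 + 2 * k : ℕ) := Nat.cast_nonneg _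
        linarith)
  have h2 : ((2 * m - 1 + 2 * k : ℕ) + 1 : ℝ) / 2 = (m + k - 1 : ℕ) + 1 := by
    have : ((2 * m - 1 + 2 * k : ℕ) + 1 : ℝ) = ((2 * ((m + k - 1) + 1) : ℕ) : ℝ) := by
      rw [← Nat.cast_add_one]; congr 1; omega
    rw [this]; push_cast; ring
  rw [h2, Real.Gamma_nat_eq_factorial] at h
  simp only [Real.rpow_natCast, Real.rpow_ofNat, pow_add, mul_assoc] at h
  rw [h]; ring

/-- Uniqueness of Haar measure. The constant need not be known, since only ratios of integrals
matter below. -/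
theorem EuclideanSpace.exists_volume_eq_smul_map_toLp (d : ℕ) :
    ∃ c : NNReal, (volume : Measure (EuclideanSpace ℂ (Fin d))) =
      c • (volume : Measure (Fin d → ℂ)).map (WithLp.toLp 2) := by
  let L : (Fin d → ℂ) ≃L[ℝ] EuclideanSpace ℂ (Fin d) :=
    ((PiLp.continuousLinearEquiv 2 ℝ fun _ : Fin d => ℂ)).symm
  have : ((volume : Measure (Fin d → ℂ)).map L).IsAddHaarMeasure :=
    L.isAddHaarMeasure_map _
  exact ⟨_, Measure.isAddLeftInvariant_eq_smul volume ((volume : Measure (Fin d → ℂ)).map L)⟩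

/-- The Gaussian factorizes over coordinates and the power affects a single factor, which it
multiplies by `k!`. -/
theorem EuclideanSpace.integral_norm_apply_pow_mul_exp_neg_sq {d : ℕ} (i₀ : Fin d) (k : ℕ) :
    ∫ x : EuclideanSpace ℂ (Fin d), ‖x i₀‖ ^ (2 * k) * Real.exp (-‖x‖ ^ 2) =
      k.factorial * ∫ x : EuclideanSpace ℂ (Fin d), Real.exp (-‖x‖ ^ 2) := by
  obtain ⟨c, hc⟩ := EuclideanSpace.exists_volume_eq_smul_map_toLp d
  have hemb : MeasurableEmbedding (WithLp.toLp 2 : (Fin d → ℂ) → EuclideanSpace ℂ (Fin d)) :=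
    (MeasurableEquiv.toLp 2 (Fin d → ℂ)).measurableEmbedding
  have key : ∀ m : ℕ, ∫ x : EuclideanSpace ℂ (Fin d), ‖x i₀‖ ^ (2 * m) * Real.exp (-‖x‖ ^ 2) =
      c * (m.factorial * Real.pi ^ d) := by
    intro m
    rw [hc, integral_smul_nnreal_measure, hemb.integral_map]
    have : ∀ y : Fin d → ℂ, ‖(WithLp.toLp 2 y : EuclideanSpace ℂ (Fin d)) i₀‖ ^ (2 * m) *
        Real.exp (-‖(WithLp.toLp 2 y : EuclideanSpace ℂ (Fin d))‖ ^ 2) =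
        ∏ i, (‖y i‖ ^ (2 * (if i = i₀ then m else 0)) * Real.exp (-‖y i‖ ^ 2)) := by
      intro y
      rw [Finset.prod_mul_distrib, ← Real.exp_sum, Finset.sum_neg_distrib,
        EuclideanSpace.norm_sq_eq, Finset.prod_eq_single i₀ (by intro b _ hb; simp [hb]) (by simp)]
      simp
    simp_rw [this]
    rw [integral_fintype_prod_volume_eq_prod
      (f := fun i (z : ℂ) => ‖z‖ ^ (2 * (if i = i₀ then m else 0)) * Real.exp (-‖z‖ ^ 2))]
    simp_rw [integral_norm_pow_mul_exp_neg_sq_complex]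
    rw [Finset.prod_mul_distrib, Finset.prod_const, Finset.card_univ, Fintype.card_fin,
      Finset.prod_eq_single i₀ (by intro b _ hb; simp [hb]) (by simp), if_pos rfl]
    rw [NNReal.smul_def, smul_eq_mul]; ring
  have h0 := key 0
  simp only [mul_zero, pow_zero, one_mul, Nat.factorial_zero, Nat.cast_one] at h0
  rw [key k, h0]; ring

/-- By unitary invariance `φ` may be taken to be a coordinate vector: complete it to an orthonormal
basis and change coordinates. -/
theorem EuclideanSpace.integral_norm_inner_pow_mul_exp_neg_sq {d : ℕ} (hd : 1 ≤ d) (k : ℕ)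
    {φ : EuclideanSpace ℂ (Fin d)} (hφ : ‖φ‖ = 1) :
    ∫ x : EuclideanSpace ℂ (Fin d), ‖inner ℂ φ x‖ ^ (2 * k) * Real.exp (-‖x‖ ^ 2) =
      k.factorial * ∫ x : EuclideanSpace ℂ (Fin d), Real.exp (-‖x‖ ^ 2) := by
  let i₀ : Fin d := ⟨0, hd⟩
  obtain ⟨b, hb⟩ := Orthonormal.exists_orthonormalBasis_extension_of_card_eq (𝕜 := ℂ)
    (E := EuclideanSpace ℂ (Fin d)) (ι := Fin d) (by simp) (v := fun _ => φ) (s := {i₀})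
    (by
      rw [orthonormal_iff_ite]
      rintro ⟨i, hi⟩ ⟨j, hj⟩
      rw [Set.mem_singleton_iff] at hi hj
      subst hi; subst hj
      simp [inner_self_eq_norm_sq_to_K, hφ])
  have hb0 : b i₀ = φ := hb i₀ rfl
  let U : EuclideanSpace ℂ (Fin d) ≃ₗᵢ[ℝ] EuclideanSpace ℂ (Fin d) :=
    { b.repr.toLinearEquiv.restrictScalars ℝ with norm_map' := b.repr.norm_map }
  have hU : ∀ x, U x = b.repr x := fun _ => rfl
  rw [← EuclideanSpace.integral_norm_apply_pow_mul_exp_neg_sq i₀ k,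
    ← U.measurePreserving.integral_comp U.toMeasurableEquiv.measurableEmbedding
      fun x => ‖x i₀‖ ^ (2 * k) * Real.exp (-‖x‖ ^ 2)]
  refine integral_congr_ae (.of_forall fun x => ?_)
  simp only [U.norm_map]
  rw [hU, b.repr_apply_apply, hb0]

instance isProbabilityMeasure_uniformSphere {d : ℕ} [NeZero d] :
    IsProbabilityMeasure (uniformSphere d) := by
  refine ⟨?_⟩
  rw [uniformSphere, Measure.smul_apply, smul_eq_mul]
  refine ENNReal.inv_mul_cancel ?_ (measure_ne_top _ _)
  rw [Ne, Measure.measure_univ_eq_zero]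
  exact Measure.toSphere_ne_zero _

/-- Moments of the overlap of a fixed unit vector with a uniformly distributed one. -/
theorem integral_norm_inner_pow_uniformSphere {d : ℕ} (hd : 1 ≤ d) (k : ℕ)
    {φ : EuclideanSpace ℂ (Fin d)} (hφ : ‖φ‖ = 1) :
    ∫ ψ, ‖inner ℂ φ (ψ : EuclideanSpace ℂ (Fin d))‖ ^ (2 * k) ∂(uniformSphere d) =
      ((Nat.choose (d + k - 1) k : ℕ) : ℝ)⁻¹ := by
  have : NeZero d := ⟨by omega⟩
  have hfin : Module.finrank ℝ (EuclideanSpace ℂ (Fin d)) = 2 * d := by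
    rw [finrank_real_of_complex]; simp
  -- Each Gaussian moment is a sphere moment times a radial factor. Comparing `m = k` with `m = 0`
  -- eliminates the Gaussian integral and leaves `k! (d-1)! / (d+k-1)!`.
  have polar : ∀ m : ℕ,
      ∫ x : EuclideanSpace ℂ (Fin d), ‖inner ℂ φ x‖ ^ (2 * m) * Real.exp (-‖x‖ ^ 2) =
      (∫ ψ : Metric.sphere (0 : EuclideanSpace ℂ (Fin d)) 1,
        ‖inner ℂ φ (ψ : EuclideanSpace ℂ (Fin d))‖ ^ (2 * m)
        ∂(volume : Measure (EuclideanSpace ℂ (Fin d))).toSphere) *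
        ((d + m - 1).factorial / 2) := by
    intro m
    rw [← integral_pow_mul_exp_neg_sq_Ioi d m hd, ← hfin]
    refine integral_eq_integral_toSphere_mul volume (f := fun x => _)
      (g := fun x => ‖inner ℂ φ x‖ ^ (2 * m)) fun u r hr => ?_
    have hu : ‖(u : EuclideanSpace ℂ (Fin d))‖ = 1 := by simp
    rw [← Complex.coe_smul, inner_smul_right, norm_mul, mul_pow, norm_smul, hu]
    simp [abs_of_pos hr]
    ring
  have hk := polar k
  have h0 := polar 0
  rw [EuclideanSpace.integral_norm_inner_pow_mul_exp_neg_sq hd k hφ] at hk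
  simp only [mul_zero, pow_zero, one_mul, add_zero, integral_const, smul_eq_mul, mul_one] at h0
  rw [h0] at hk
  set V := (volume : Measure (EuclideanSpace ℂ (Fin d))).toSphere.real Set.univ with hV
  have hVpos : 0 < V := by
    refine ENNReal.toReal_pos ?_ (measure_ne_top _ _)
    rw [Ne, Measure.measure_univ_eq_zero]
    exact Measure.toSphere_ne_zero _
  rw [uniformSphere, integral_smul_measure, ENNReal.toReal_inv, smul_eq_mul]
  change V⁻¹ * _ = _
  have hch : ((d + k - 1).choose k : ℝ) * (k.factorial * (d - 1).factorial) =
      (d + k - 1).factorial := by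
    have := Nat.choose_mul_factorial_mul_factorial (n := d + k - 1) (k := k) (by omega)
    rw [show d + k - 1 - k = d - 1 by omega] at this
    rw [← mul_assoc]; exact_mod_cast this
  have hc0 : ((d + k - 1).choose k : ℝ) ≠ 0 := by
    exact_mod_cast (Nat.choose_pos (by omega)).ne'
  have hd0 : ((d - 1).factorial : ℝ) ≠ 0 := by exact_mod_cast Nat.factorial_ne_zero _
  have hk0 : (k.factorial : ℝ) ≠ 0 := by exact_mod_cast Nat.factorial_ne_zero _
  rw [← hch] at hk
  rw [inv_mul_eq_iff_eq_mul₀ hVpos.ne', ← div_eq_mul_inv, eq_div_iff hc0]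
  refine mul_right_cancel₀ (mul_ne_zero hk0 hd0) ?_
  linear_combination -2 * hk

/-! ### Positive semidefinite matrices, expectation values and tensor powers -/

open Matrix in
/-- Spectral decomposition of a positive semidefinite matrix into unit vectors. -/
theorem Matrix.PosSemidef.exists_eq_sum_mul_star {d : ℕ} {A : Matrix (Fin d) (Fin d) ℂ}
    (hA : A.PosSemidef) : ∃ (c : Fin d → ℝ) (e : Fin d → EuclideanSpace ℂ (Fin d)),
      (∀ m, 0 ≤ c m) ∧ (∀ m, ‖e m‖ = 1) ∧ (∀ i j, A i j = ∑ m, c m * (e m i * star (e m j))) ∧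
      ∑ m, c m = A.trace.re := by
  have hex : ∀ i j, A i j = ∑ m, hA.1.eigenvalues m *
      (hA.1.eigenvectorBasis m i * star (hA.1.eigenvectorBasis m j)) := by
    intro i j
    conv_lhs => rw [hA.1.spectral_theorem]
    rw [Unitary.conjStarAlgAut_apply, mul_apply]
    refine Finset.sum_congr rfl fun m _ => ?_
    rw [mul_diagonal, star_apply, IsHermitian.eigenvectorUnitary_apply,
      IsHermitian.eigenvectorUnitary_apply]
    simp only [Function.comp_apply, Complex.coe_algebraMap]
    change _ * ((hA.1.eigenvalues m : ℝ) : ℂ) * _ = _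
    ring
  refine ⟨hA.1.eigenvalues, hA.1.eigenvectorBasis, hA.eigenvalues_nonneg,
    hA.1.eigenvectorBasis.orthonormal.1, hex, ?_⟩
  rw [hA.1.trace_eq_sum_eigenvalues]
  simp

theorem Matrix.PosSemidef.norm_apply_le_trace {d : ℕ} {A : Matrix (Fin d) (Fin d) ℂ}
    (hA : A.PosSemidef) (i j : Fin d) : ‖A i j‖ ≤ A.trace.re := by
  obtain ⟨c, e, hc, he, hAe, hs⟩ := hA.exists_eq_sum_mul_star
  rw [hAe, ← hs]
  refine (norm_sum_le _ _).trans (Finset.sum_le_sum fun m _ => ?_)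
  have h : ∀ i, ‖e m i‖ ≤ 1 := fun i => (PiLp.norm_apply_le (e m) i).trans (he m).le
  rw [norm_mul, norm_mul, norm_star, Complex.norm_real, Real.norm_of_nonneg (hc m)]
  exact mul_le_of_le_one_right (hc m) (mul_le_one₀ (h i) (norm_nonneg _) (h j))

theorem Matrix.PosSemidef.trace_eq_ofReal {d : ℕ} {A : Matrix (Fin d) (Fin d) ℂ}
    (hA : A.PosSemidef) : A.trace = (A.trace.re : ℂ) :=
  Complex.eq_re_of_ofReal_le (r := 0) (by simpa using hA.trace_nonneg)

theorem Matrix.PosSemidef.trace_re_nonneg {d : ℕ} {A : Matrix (Fin d) (Fin d) ℂ}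
    (hA : A.PosSemidef) : 0 ≤ A.trace.re :=
  (Complex.le_def.1 hA.trace_nonneg).1

/-- The expectation value `⟨v|A|v⟩`. -/
def expectationValue {d : ℕ} (A : Matrix (Fin d) (Fin d) ℂ) (v : EuclideanSpace ℂ (Fin d)) : ℂ :=
  ∑ i, ∑ j, star (v i) * v j * A i j

theorem expectationValue_sum_mul_star {d : ℕ} {A : Matrix (Fin d) (Fin d) ℂ} {c : Fin d → ℝ}
    {e : Fin d → EuclideanSpace ℂ (Fin d)}
    (hA : ∀ i j, A i j = ∑ m, c m * (e m i * star (e m j))) (v : EuclideanSpace ℂ (Fin d)) :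
    expectationValue A v = ((∑ m, c m * ‖inner ℂ v (e m)‖ ^ 2 : ℝ) : ℂ) := by
  have : ∀ m, ((‖inner ℂ v (e m)‖ ^ 2 : ℝ) : ℂ) =
      ∑ i, ∑ j, star (v i) * v j * (e m i * star (e m j)) := by
    intro m
    rw [Complex.ofReal_pow, ← Complex.mul_conj', PiLp.inner_apply, map_sum, Finset.sum_mul_sum]
    refine Finset.sum_congr rfl fun i _ => Finset.sum_congr rfl fun j _ => ?_
    simp
    ring
  rw [Complex.ofReal_sum]
  simp_rw [Complex.ofReal_mul, this, Finset.mul_sum]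
  rw [Finset.sum_comm, expectationValue]
  refine Finset.sum_congr rfl fun i _ => ?_
  rw [Finset.sum_comm]
  refine Finset.sum_congr rfl fun j _ => ?_
  rw [hA, Finset.mul_sum]
  exact Finset.sum_congr rfl fun m _ => by ring

theorem expectationValue_pureState {d : ℕ} (v ψ : EuclideanSpace ℂ (Fin d)) :
    expectationValue (pureState ψ) v = ((‖inner ℂ v ψ‖ ^ 2 : ℝ) : ℂ) := by
  rw [Complex.ofReal_pow, ← Complex.mul_conj', PiLp.inner_apply, map_sum, Finset.sum_mul_sum,
    expectationValue]
  refine Finset.sum_congr rfl fun i _ => Finset.sum_congr rfl fun j _ => ?_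
  simp [pureState]
  ring

theorem Matrix.PosSemidef.expectationValue_eq_ofReal {d : ℕ} {A : Matrix (Fin d) (Fin d) ℂ}
    (hA : A.PosSemidef) (v : EuclideanSpace ℂ (Fin d)) :
    expectationValue A v = ((expectationValue A v).re : ℂ) := by
  obtain ⟨c, e, hc, he, hAe, hs⟩ := hA.exists_eq_sum_mul_star
  rw [expectationValue_sum_mul_star hAe, Complex.ofReal_re]

theorem Matrix.PosSemidef.expectationValue_nonneg {d : ℕ} {A : Matrix (Fin d) (Fin d) ℂ}
    (hA : A.PosSemidef) (v : EuclideanSpace ℂ (Fin d)) : 0 ≤ (expectationValue A v).re := by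
  obtain ⟨c, e, hc, he, hAe, hs⟩ := hA.exists_eq_sum_mul_star
  rw [expectationValue_sum_mul_star hAe, Complex.ofReal_re]
  exact Finset.sum_nonneg fun m _ => mul_nonneg (hc m) (sq_nonneg _)

theorem Matrix.PosSemidef.expectationValue_le_trace {d : ℕ} {A : Matrix (Fin d) (Fin d) ℂ}
    (hA : A.PosSemidef) {v : EuclideanSpace ℂ (Fin d)} (hv : ‖v‖ = 1) :
    (expectationValue A v).re ≤ A.trace.re := by
  obtain ⟨c, e, hc, he, hAe, hs⟩ := hA.exists_eq_sum_mul_star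
  rw [expectationValue_sum_mul_star hAe, Complex.ofReal_re, ← hs]
  refine Finset.sum_le_sum fun m _ => mul_le_of_le_one_right (hc m) ?_
  refine pow_le_one₀ (norm_nonneg _) ((norm_inner_le_norm _ _).trans ?_)
  rw [hv, he, one_mul]

/-- Born rule for a mixture of pure states. -/
theorem trace_mul_eq_sum_expectationValue {d : ℕ} {A : Matrix (Fin d) (Fin d) ℂ} {c : Fin d → ℝ}
    {e : Fin d → EuclideanSpace ℂ (Fin d)}
    (hA : ∀ i j, A i j = ∑ m, c m * (e m i * star (e m j))) (B : Matrix (Fin d) (Fin d) ℂ) :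
    (A * B).trace.re = ∑ m, c m * (expectationValue B (e m)).re := by
  have : (A * B).trace = ∑ m, (c m : ℂ) * expectationValue B (e m) := by
    simp_rw [Matrix.trace, Matrix.diag_apply, Matrix.mul_apply, expectationValue, Finset.mul_sum]
    rw [Finset.sum_comm]
    conv_rhs => rw [Finset.sum_comm]
    refine Finset.sum_congr rfl fun i _ => ?_
    conv_rhs => rw [Finset.sum_comm]
    refine Finset.sum_congr rfl fun j _ => ?_
    rw [hA, Finset.sum_mul]
    exact Finset.sum_congr rfl fun m _ => by ring
  rw [this, Complex.re_sum]
  exact Finset.sum_congr rfl fun m _ => by rw [Complex.re_ofReal_mul]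

theorem Matrix.PosSemidef.trace_mul_re_nonneg {d : ℕ} {A B : Matrix (Fin d) (Fin d) ℂ}
    (hA : A.PosSemidef) (hB : B.PosSemidef) : 0 ≤ (A * B).trace.re := by
  obtain ⟨c, e, hc, he, hAe, hs⟩ := hA.exists_eq_sum_mul_star
  rw [trace_mul_eq_sum_expectationValue hAe]
  exact Finset.sum_nonneg fun m _ => mul_nonneg (hc m) (hB.expectationValue_nonneg _)

/-- This keeps `overlap` at most `1`, and makes the Born density vanish wherever one of the traces
does. -/
theorem Matrix.PosSemidef.trace_mul_re_le {d : ℕ} {A B : Matrix (Fin d) (Fin d) ℂ}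
    (hA : A.PosSemidef) (hB : B.PosSemidef) : (A * B).trace.re ≤ A.trace.re * B.trace.re := by
  obtain ⟨c, e, hc, he, hAe, hs⟩ := hA.exists_eq_sum_mul_star
  rw [trace_mul_eq_sum_expectationValue hAe, ← hs, Finset.sum_mul]
  exact Finset.sum_le_sum fun m _ =>
    mul_le_mul_of_nonneg_left (hB.expectationValue_le_trace (he m)) (hc m)

/-- Contraction with `v ^ ⊗k` on both sides; it turns the entrywise design condition into scalar
moments. -/
theorem sum_mul_tensorPower {d : ℕ} (k : ℕ) (A : Matrix (Fin d) (Fin d) ℂ)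
    (v : EuclideanSpace ℂ (Fin d)) :
    ∑ i : Fin k → Fin d, ∑ j : Fin k → Fin d,
      (∏ s, star (v (i s)) * v (j s)) * tensorPower k A i j = expectationValue A v ^ k := by
  have h1 : expectationValue A v = ∑ a : Fin d × Fin d, star (v a.1) * v a.2 * A a.1 a.2 := by
    rw [Fintype.sum_prod_type, expectationValue]
  rw [h1, Finset.sum_pow', Fintype.piFinset_univ, ← Fintype.sum_prod_type',
    ← (Equiv.arrowProdEquivProdArrow (Fin k) (fun _ => Fin d) fun _ => Fin d).sum_comp]
  refine Finset.sum_congr rfl fun p _ => ?_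
  rw [Finset.prod_mul_distrib (f := fun s => star (v (p s).1) * v (p s).2)]
  rfl

/-- Each of the `k` entries is at most the trace, and the denominator cancels all but one factor.
This is the integrable majorant that permits exchanging sums and design integrals. -/
theorem norm_tensorPower_div_le {d : ℕ} {A : Matrix (Fin d) (Fin d) ℂ} (hA : A.PosSemidef)
    {k : ℕ} (hk : 1 ≤ k) (i j : Fin k → Fin d) :
    ‖tensorPower k A i j / A.trace ^ (k - 1)‖ ≤ A.trace.re := by
  have h0 := hA.trace_re_nonneg
  have h1 : ‖tensorPower k A i j‖ ≤ A.trace.re ^ k := by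
    rw [tensorPower, Matrix.of_apply, norm_prod]
    refine (Finset.prod_le_prod (fun s _ => norm_nonneg _)
      fun s _ => hA.norm_apply_le_trace (i s) (j s)).trans ?_
    simp
  rw [norm_div, norm_pow, hA.trace_eq_ofReal, Complex.norm_real, Real.norm_of_nonneg h0,
    ← hA.trace_eq_ofReal]
  obtain ⟨m, rfl⟩ : ∃ m, k = m + 1 := ⟨k - 1, by omega⟩
  refine div_le_of_le_mul₀ (by positivity) h0 (h1.trans_eq ?_)
  rw [Nat.add_sub_cancel, pow_succ']

/-! ### Averages over a design -/

section Design

variable {d t : ℕ} {A : ℝ → Matrix (Fin d) (Fin d) ℂ}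

theorem measurable_trace_of_entry (hm : ∀ i j, Measurable fun y => A y i j) :
    Measurable fun y => (A y).trace := by
  simp only [Matrix.trace, Matrix.diag_apply]; fun_prop

theorem measurable_expectationValue (hm : ∀ i j, Measurable fun y => A y i j)
    (v : EuclideanSpace ℂ (Fin d)) : Measurable fun y => expectationValue (A y) v := by
  simp only [expectationValue]; fun_prop

/-- A spherical design reproduces the moments of the overlap with a fixed unit vector. -/
theorem IsSphericalDesign.integral_trace_mul_pow (hd : 1 ≤ d)
    (hm : ∀ i j, Measurable fun y => A y i j)
    (hpsd : ∀ y, (A y).PosSemidef) (hint : Integrable fun y => (A y).trace.re)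
    (hdes : IsSphericalDesign t A) {k : ℕ} (hk : 1 ≤ k) (hkt : k ≤ t)
    {v : EuclideanSpace ℂ (Fin d)} (hv : ‖v‖ = 1) :
    ∫ y, (A y).trace.re * ((expectationValue (A y) v).re / (A y).trace.re) ^ k =
      ((Nat.choose (d + k - 1) k : ℕ) : ℝ)⁻¹ := by
  have : NeZero d := ⟨by omega⟩
  have hmt := measurable_trace_of_entry hm
  have hI : ∀ i j : Fin k → Fin d,
      Integrable fun y => tensorPower k (A y) i j / (A y).trace ^ (k - 1) := by
    intro i j
    refine hint.mono' (Measurable.aestronglyMeasurable ?_)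
      (.of_forall fun y => norm_tensorPower_div_le (hpsd y) hk i j)
    simp only [tensorPower, Matrix.of_apply]
    fun_prop
  have hS : ∀ i j : Fin k → Fin d, Integrable (fun ψ : Metric.sphere
      (0 : EuclideanSpace ℂ (Fin d)) 1 =>
        tensorPower k (pureState (ψ : EuclideanSpace ℂ (Fin d))) i j) (uniformSphere d) := by
    intro i j
    refine Continuous.integrable_of_hasCompactSupport ?_ (HasCompactSupport.of_compactSpace _)
    simp only [tensorPower, pureState, Matrix.of_apply]
    fun_prop
  have hL : ∀ y, (((A y).trace.re * ((expectationValue (A y) v).re / (A y).trace.re) ^ k : ℝ) : ℂ) =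
      ∑ i : Fin k → Fin d, ∑ j : Fin k → Fin d, (∏ s, star (v (i s)) * v (j s)) *
        (tensorPower k (A y) i j / (A y).trace ^ (k - 1)) := by
    intro y
    simp_rw [mul_div_assoc', ← Finset.sum_div]
    rw [sum_mul_tensorPower, (hpsd y).expectationValue_eq_ofReal, (hpsd y).trace_eq_ofReal]
    simp only [Complex.ofReal_re]
    rw [← Complex.ofReal_pow, ← Complex.ofReal_pow, ← Complex.ofReal_div]
    congr 1
    obtain ⟨m, rfl⟩ : ∃ m, k = m + 1 := ⟨k - 1, by omega⟩
    rw [Nat.add_sub_cancel]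
    by_cases h : (A y).trace.re = 0
    -- Where the trace vanishes, so does the expectation value, and division by zero leaves `0` on
    -- both sides.
    · have h1 : (expectationValue (A y) v).re = 0 := le_antisymm
        (h ▸ (hpsd y).expectationValue_le_trace hv) ((hpsd y).expectationValue_nonneg v)
      simp [h, h1]
    · rw [div_pow, pow_succ (A y).trace.re m]
      field_simp
  have hR : ∀ ψ : Metric.sphere (0 : EuclideanSpace ℂ (Fin d)) 1,
      ((‖inner ℂ v (ψ : EuclideanSpace ℂ (Fin d))‖ ^ (2 * k) : ℝ) : ℂ) =
      ∑ i : Fin k → Fin d, ∑ j : Fin k → Fin d, (∏ s, star (v (i s)) * v (j s)) *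
        tensorPower k (pureState (ψ : EuclideanSpace ℂ (Fin d))) i j := by
    intro ψ
    rw [sum_mul_tensorPower, expectationValue_pureState, ← Complex.ofReal_pow, pow_mul]
  rw [← integral_norm_inner_pow_uniformSphere hd k hv]
  apply Complex.ofReal_injective
  rw [← integral_complex_ofReal, ← integral_complex_ofReal]
  simp_rw [hL, hR]
  rw [integral_finsetSum _ fun i _ => integrable_finsetSum _ fun j _ => (hI i j).const_mul _,
    integral_finsetSum _ fun i _ => integrable_finsetSum _ fun j _ => (hS i j).const_mul _]
  refine Finset.sum_congr rfl fun i _ => ?_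
  rw [integral_finsetSum _ fun j _ => (hI i j).const_mul _,
    integral_finsetSum _ fun j _ => (hS i j).const_mul _]
  refine Finset.sum_congr rfl fun j _ => ?_
  rw [integral_const_mul, integral_const_mul, hdes k hk hkt]

theorem Polynomial.eval_eq_sum_Icc {p : Polynomial ℝ} (hp : p.natDegree ≤ t)
    (h0 : p.coeff 0 = 0) (s : ℝ) : p.eval s = ∑ k ∈ Finset.Icc 1 t, p.coeff k * s ^ k := by
  rw [p.eval_eq_sum_range' (Nat.lt_succ_of_le hp), Finset.sum_range_succ', h0, zero_mul, add_zero,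
    Finset.range_eq_Ico, Finset.sum_Ico_add' (fun k => p.coeff k * s ^ k) 0 t 1]
  rfl

/-- Lower bound for the averaged entropy function of a design. -/
theorem IsSphericalDesign.sum_coeff_le_integral_negMulLog (hd : 1 ≤ d)
    (hm : ∀ i j, Measurable fun y => A y i j)
    (hpsd : ∀ y, (A y).PosSemidef) (hint : Integrable fun y => (A y).trace.re)
    (hdes : IsSphericalDesign t A) {p : Polynomial ℝ} (hp : p.natDegree ≤ t)
    (hp0 : p.coeff 0 = 0) (hpη : ∀ s, 0 ≤ s → s ≤ 1 → p.eval s ≤ Real.negMulLog s)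
    {σ : Matrix (Fin d) (Fin d) ℂ} (hσ : σ.PosSemidef) (hσ1 : σ.trace.re = 1) :
    ∑ k ∈ Finset.Icc 1 t, p.coeff k * ((Nat.choose (d + k - 1) k : ℕ) : ℝ)⁻¹ ≤
      ∫ y, (A y).trace.re * Real.negMulLog ((σ * A y).trace.re / (A y).trace.re) := by
  obtain ⟨c, e, hc, he, hσe, hs⟩ := hσ.exists_eq_sum_mul_star
  rw [hσ1] at hs
  have hmt : Measurable fun y => (A y).trace := measurable_trace_of_entry hm
  set s : Fin d → ℝ → ℝ := fun m y => (expectationValue (A y) (e m)).re / (A y).trace.re with hsdef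
  have hsm : ∀ m, Measurable (s m) := fun m =>
    (Complex.measurable_re.comp (measurable_expectationValue hm (e m))).div
      (Complex.measurable_re.comp hmt)
  have hs0 : ∀ m y, 0 ≤ s m y := fun m y =>
    div_nonneg ((hpsd y).expectationValue_nonneg _) (hpsd y).trace_re_nonneg
  have hs1 : ∀ m y, s m y ≤ 1 := fun m y =>
    div_le_one_of_le₀ ((hpsd y).expectationValue_le_trace (he m)) (hpsd y).trace_re_nonneg
  have hτ : ∀ y, (σ * A y).trace.re / (A y).trace.re = ∑ m, c m * s m y := fun y => by
    rw [trace_mul_eq_sum_expectationValue hσe, Finset.sum_div]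
    exact Finset.sum_congr rfl fun m _ => mul_div_assoc _ _ _
  have hmix0 : ∀ y, 0 ≤ ∑ m, c m * s m y := fun y =>
    Finset.sum_nonneg fun m _ => mul_nonneg (hc m) (hs0 m y)
  have hmix1 : ∀ y, ∑ m, c m * s m y ≤ 1 := fun y => by
    rw [← hs]
    exact Finset.sum_le_sum fun m _ => mul_le_of_le_one_right (hc m) (hs1 m y)
  have hpow : ∀ k m, Integrable fun y => (A y).trace.re * s m y ^ k := fun k m => by
    refine hint.mono' ?_ (.of_forall fun y => ?_)
    · exact ((Complex.measurable_re.comp hmt).mul ((hsm m).pow_const k)).aestronglyMeasurable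
    · rw [Real.norm_of_nonneg (mul_nonneg (hpsd y).trace_re_nonneg (pow_nonneg (hs0 m y) k))]
      exact mul_le_of_le_one_right (hpsd y).trace_re_nonneg (pow_le_one₀ (hs0 m y) (hs1 m y))
  -- The moments are the same for every unit vector `e m`, so the weights `c m` just sum to `1`.
  have heq : ∑ k ∈ Finset.Icc 1 t, p.coeff k * ((Nat.choose (d + k - 1) k : ℕ) : ℝ)⁻¹ =
      ∫ y, ∑ m, ∑ k ∈ Finset.Icc 1 t, c m * p.coeff k * ((A y).trace.re * s m y ^ k) := by
    rw [integral_finsetSum _ fun m _ => integrable_finsetSum _ fun k _ => (hpow k m).const_mul _]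
    have : ∀ m, ∫ y, ∑ k ∈ Finset.Icc 1 t, c m * p.coeff k * ((A y).trace.re * s m y ^ k) =
        c m * ∑ k ∈ Finset.Icc 1 t, p.coeff k * ((Nat.choose (d + k - 1) k : ℕ) : ℝ)⁻¹ := by
      intro m
      rw [integral_finsetSum _ fun k _ => (hpow k m).const_mul _, Finset.mul_sum]
      refine Finset.sum_congr rfl fun k hk => ?_
      rw [Finset.mem_Icc] at hk
      rw [integral_const_mul,
        hdes.integral_trace_mul_pow hd hm hpsd hint hk.1 hk.2 (he m), mul_assoc]
    simp_rw [this]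
    rw [← Finset.sum_mul, hs, one_mul]
  rw [heq]
  refine integral_mono (integrable_finsetSum _ fun m _ => integrable_finsetSum _ fun k _ =>
    (hpow k m).const_mul _) ?_ fun y => ?_
  · refine hint.mono' ?_ (.of_forall fun y => ?_)
    · simp_rw [hτ]
      exact ((Complex.measurable_re.comp hmt).mul (Real.continuous_negMulLog.measurable.comp
        (Finset.measurable_sum _ fun m _ => (hsm m).const_mul _))).aestronglyMeasurable
    · rw [hτ, Real.norm_of_nonneg (mul_nonneg (hpsd y).trace_re_nonneg
        (Real.negMulLog_nonneg (hmix0 y) (hmix1 y)))]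
      refine mul_le_of_le_one_right (hpsd y).trace_re_nonneg ?_
      exact (Real.negMulLog_le_one_sub_self (hmix0 y)).trans (sub_le_self _ (hmix0 y))
  -- Jensen over the pure components of `σ`, then `p ≤ η` at each overlap `s m y`.
  · have hconc := Real.concaveOn_negMulLog.le_map_sum (t := Finset.univ) (w := c)
      (p := fun m => s m y) (fun m _ => hc m) hs (fun m _ => hs0 m y)
    simp only [smul_eq_mul] at hconc
    change _ ≤ (A y).trace.re * Real.negMulLog ((σ * A y).trace.re / (A y).trace.re)
    rw [hτ]
    refine le_trans ?_ (mul_le_mul_of_nonneg_left hconc (hpsd y).trace_re_nonneg)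
    rw [Finset.mul_sum]
    refine Finset.sum_le_sum fun m _ => ?_
    have := mul_le_mul_of_nonneg_left (mul_le_mul_of_nonneg_left
      (hpη (s m y) (hs0 m y) (hs1 m y)) (hc m)) (hpsd y).trace_re_nonneg
    refine le_trans (le_of_eq ?_) this
    rw [Polynomial.eval_eq_sum_Icc hp hp0, Finset.mul_sum, Finset.mul_sum]
    exact Finset.sum_congr rfl fun k _ => by ring

end Design

/-! ### Relative entropy to a product measure -/

open InformationTheory ProbabilityTheory in
/-- Among all product measures with a fixed first marginal, the product of the marginals minimizes
the relative entropy. -/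
theorem klDiv_fst_prod_snd_le {α β : Type*} [MeasurableSpace α] [MeasurableSpace β]
    [StandardBorelSpace α] [Nonempty α] (P : Measure (α × β)) [IsProbabilityMeasure P]
    (Q : Measure β) [IsProbabilityMeasure Q] :
    klDiv P (P.fst.prod P.snd) ≤ klDiv P (P.fst.prod Q) := by
  -- After the swap the factor being varied comes first, so the chain rule splits off the
  -- nonnegative term `klDiv P.snd Q`, which is dropped.
  set P' := P.map Prod.swap with hP'
  have : IsProbabilityMeasure P' := Measure.isProbabilityMeasure_map measurable_swap.aemeasurable
  have hfst : P'.fst = P.snd := Measure.fst_map_swap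
  have hdis : P.snd ⊗ₘ P'.condKernel = P' := by rw [← hfst]; exact P'.disintegrate _
  calc klDiv P (P.fst.prod P.snd)
      = klDiv (P'.map Prod.swap) ((P.snd.prod P.fst).map Prod.swap) := by
        rw [Measure.prod_swap, hP', Measure.map_map measurable_swap measurable_swap,
          Prod.swap_swap_eq, Measure.map_id]
    _ ≤ klDiv P' (P.snd.prod P.fst) := klDiv_map_le _ _ measurable_swap
    _ ≤ klDiv P' (Q.prod P.fst) := by
        rw [← Measure.compProd_const, ← Measure.compProd_const, ← hdis,
          klDiv_compProd_eq_add P.snd Q]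
        exact le_add_self
    _ = klDiv (P.map Prod.swap) ((P.fst.prod Q).map Prod.swap) := by rw [Measure.prod_swap]
    _ ≤ klDiv P (P.fst.prod Q) := klDiv_map_le _ _ measurable_swap

open InformationTheory in
/-- Relative entropy of a measure with density `d * s` where `0 ≤ s ≤ 1`. -/
theorem klDiv_withDensity_mul_eq {α : Type*} [MeasurableSpace α] (ν : Measure α)
    [IsProbabilityMeasure ν] {D : ℝ} (hD : 0 < D) {s : α → ℝ} (hs : Measurable s)
    (hs0 : ∀ z, 0 ≤ s z) (hs1 : ∀ z, s z ≤ 1)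
    [IsProbabilityMeasure (ν.withDensity fun z => ENNReal.ofReal (D * s z))] :
    klDiv (ν.withDensity fun z => ENNReal.ofReal (D * s z)) ν =
      ENNReal.ofReal (Real.log D - D * ∫ z, Real.negMulLog (s z) ∂ν) := by
  have hsi : Integrable s ν := by
    refine (integrable_const (1 : ℝ)).mono' hs.aestronglyMeasurable (.of_forall fun z => ?_)
    rw [Real.norm_of_nonneg (hs0 z)]; exact hs1 z
  have hηi : Integrable (fun z => Real.negMulLog (s z)) ν := by
    refine (integrable_const (1 : ℝ)).mono'
      (Real.continuous_negMulLog.measurable.comp hs).aestronglyMeasurable (.of_forall fun z => ?_)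
    rw [Real.norm_of_nonneg (Real.negMulLog_nonneg (hs0 z) (hs1 z))]
    exact (Real.negMulLog_le_one_sub_self (hs0 z)).trans (sub_le_self _ (hs0 z))
  have hrn : ∀ z, 0 ≤ D * s z := fun z => mul_nonneg hD.le (hs0 z)
  have hone : ∫ z, D * s z ∂ν = 1 := by
    have h := measure_univ (μ := ν.withDensity fun z => ENNReal.ofReal (D * s z))
    rw [withDensity_apply _ MeasurableSet.univ, Measure.restrict_univ] at h
    rw [integral_eq_lintegral_of_nonneg_ae (.of_forall hrn)
      (hs.const_mul D).aestronglyMeasurable, h, ENNReal.toReal_one]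
  -- The logarithm splits into `log D` and `log s`; since `D * s` integrates to `1`, the terms `1 -
  -- D * s` contribute nothing.
  have hkl : ∀ z, klFun (D * s z) =
      (D * s z * Real.log D - D * Real.negMulLog (s z)) + 1 - D * s z := by
    intro z
    rw [klFun_apply, Real.negMulLog]
    by_cases h : s z = 0
    · simp [h]
    · rw [Real.log_mul hD.ne' h]; ring
  have hi1 : Integrable (fun z => D * s z * Real.log D) ν := (hsi.const_mul D).mul_const _
  have hi2 : Integrable (fun z => D * Real.negMulLog (s z)) ν := hηi.const_mul D
  have hki : Integrable (fun z => klFun (D * s z)) ν := by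
    simp_rw [hkl]
    exact ((hi1.sub hi2).add (integrable_const 1)).sub (hsi.const_mul D)
  have hval : ∫ z, klFun (D * s z) ∂ν = Real.log D - D * ∫ z, Real.negMulLog (s z) ∂ν := by
    simp_rw [hkl]
    have e1 := integral_sub ((hi1.sub hi2).add (integrable_const 1)) (hsi.const_mul D)
    have e2 := integral_add (hi1.sub hi2) (integrable_const (1 : ℝ))
    have e3 := integral_sub hi1 hi2
    simp only [Pi.add_apply, Pi.sub_apply] at e1 e2 e3
    rw [e1, e2, e3, integral_mul_const, hone, integral_const_mul]
    simp
  rw [klDiv_eq_lintegral_klFun_of_ac (withDensity_absolutelyContinuous _ _), ← hval,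
    ofReal_integral_eq_lintegral_ofReal hki (.of_forall fun z => klFun_nonneg (hrn z))]
  refine lintegral_congr_ae ?_
  filter_upwards [Measure.rnDeriv_withDensity ν
    (f := fun z => ENNReal.ofReal (D * s z)) (hs.const_mul D).ennreal_ofReal] with z hz
  rw [hz, ENNReal.toReal_ofReal (hrn z)]

/-! ### The joint law and its density -/

section Laws

variable {d : ℕ} (ρ : Ensemble d) (π : POVM d)

/-- A non-integrable function has integral `0` by convention, so the normalization already forces
integrability. -/
theorem Ensemble.integrable_trace : Integrable fun x => (ρ.state x).trace.re :=
  Integrable.of_integral_ne_zero (by rw [ρ.integral_trace]; exact one_ne_zero)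

theorem POVM.integrable_trace : Integrable fun y => (π.effect y).trace.re := by
  have : Integrable fun y => (π.effect y).trace := by
    simp only [Matrix.trace, Matrix.diag_apply]
    exact integrable_finsetSum _ fun i _ => π.integrable_entry i i
  exact this.re

theorem POVM.integral_trace : ∫ y, (π.effect y).trace.re = d := by
  have h : Integrable fun y => (π.effect y).trace := by
    simp only [Matrix.trace, Matrix.diag_apply]
    exact integrable_finsetSum _ fun i _ => π.integrable_entry i i
  have h2 : ∫ y, (π.effect y).trace = d := by
    simp only [Matrix.trace, Matrix.diag_apply]
    rw [integral_finsetSum _ fun i _ => π.integrable_entry i i]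
    simp [π.integral_effect]
  rw [show ∫ y, (π.effect y).trace.re = (∫ y, (π.effect y).trace).re from
    integral_re h, h2, Complex.natCast_re]

theorem measurable_bornDensity :
    Measurable fun z : ℝ × ℝ => (ρ.state z.1 * π.effect z.2).trace.re := by
  have h1 : ∀ i j, Measurable fun z : ℝ × ℝ => ρ.state z.1 i j := fun i j =>
    (ρ.measurable_entry i j).comp measurable_fst
  have h2 : ∀ i j, Measurable fun z : ℝ × ℝ => π.effect z.2 i j := fun i j =>
    (π.measurable_entry i j).comp measurable_snd
  simp only [Matrix.trace, Matrix.diag_apply, Matrix.mul_apply]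
  exact Complex.measurable_re.comp (Finset.measurable_sum _ fun i _ =>
    Finset.measurable_sum _ fun j _ => (h1 i j).mul (h2 j i))

theorem Ensemble.measurable_trace_re : Measurable fun x => (ρ.state x).trace.re :=
  Complex.measurable_re.comp (measurable_trace_of_entry ρ.measurable_entry)

theorem POVM.measurable_trace_re : Measurable fun y => (π.effect y).trace.re :=
  Complex.measurable_re.comp (measurable_trace_of_entry π.measurable_entry)

theorem POVM.lintegral_trace_mul {M : Matrix (Fin d) (Fin d) ℂ} (hM : M.PosSemidef) :
    ∫⁻ y, ENNReal.ofReal (M * π.effect y).trace.re = ENNReal.ofReal M.trace.re := by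
  have hi : ∀ i j, Integrable fun y => M i j * π.effect y j i := fun i j =>
    (π.integrable_entry j i).const_mul _
  have h : Integrable fun y => (M * π.effect y).trace := by
    simp only [Matrix.trace, Matrix.diag_apply, Matrix.mul_apply]
    exact integrable_finsetSum _ fun i _ => integrable_finsetSum _ fun j _ => hi i j
  have h2 : ∫ y, (M * π.effect y).trace = M.trace := by
    simp only [Matrix.trace, Matrix.diag_apply, Matrix.mul_apply]
    rw [integral_finsetSum _ fun i _ => integrable_finsetSum _ fun j _ => hi i j]
    refine Finset.sum_congr rfl fun i _ => ?_
    rw [integral_finsetSum _ fun j _ => hi i j]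
    simp_rw [integral_const_mul, π.integral_effect]
    simp [Matrix.one_apply]
  have hre : Integrable fun y => (M * π.effect y).trace.re := h.re
  rw [← ofReal_integral_eq_lintegral_ofReal hre
    (.of_forall fun y => hM.trace_mul_re_nonneg (π.posSemidef y)),
    show ∫ y, (M * π.effect y).trace.re = (∫ y, (M * π.effect y).trace).re from
    integral_re h, h2]

/-- The law of the input. -/
noncomputable def inputLaw : Measure ℝ := volume.withDensity fun x => ENNReal.ofReal (ρ.state x).trace.re

/-- The law of the outcome for the maximally mixed input. -/
noncomputable def uniformOutcomeLaw : Measure ℝ :=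
  volume.withDensity fun y => ENNReal.ofReal ((π.effect y).trace.re / d)

instance : IsProbabilityMeasure (inputLaw ρ) := by
  refine ⟨?_⟩
  rw [inputLaw, withDensity_apply _ MeasurableSet.univ, Measure.restrict_univ,
    ← ofReal_integral_eq_lintegral_ofReal ρ.integrable_trace
      (.of_forall fun x => (ρ.posSemidef x).trace_re_nonneg), ρ.integral_trace, ENNReal.ofReal_one]

theorem isProbabilityMeasure_uniformOutcomeLaw (hd : 1 ≤ d) :
    IsProbabilityMeasure (uniformOutcomeLaw π) := by
  have hd0 : (d : ℝ) ≠ 0 := by exact_mod_cast (by omega : d ≠ 0)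
  refine ⟨?_⟩
  rw [uniformOutcomeLaw, withDensity_apply _ MeasurableSet.univ, Measure.restrict_univ,
    ← ofReal_integral_eq_lintegral_ofReal (π.integrable_trace.div_const _)
      (.of_forall fun y => div_nonneg (π.posSemidef y).trace_re_nonneg (Nat.cast_nonneg _)),
    integral_div, π.integral_trace, div_self hd0, ENNReal.ofReal_one]

theorem fst_prod_withDensity {α β : Type*} [MeasurableSpace α] [MeasurableSpace β]
    (μ : Measure α) (ν : Measure β) [SFinite μ] [SFinite ν] {f : α × β → ℝ≥0∞}
    (hf : Measurable f) :
    ((μ.prod ν).withDensity f).fst = μ.withDensity fun x => ∫⁻ y, f (x, y) ∂ν := by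
  ext s hs
  rw [Measure.fst_apply hs, ← Set.prod_univ, withDensity_apply _ (hs.prod MeasurableSet.univ),
    withDensity_apply _ hs, ← Measure.prod_restrict, Measure.restrict_univ,
    lintegral_prod _ hf.aemeasurable]

theorem jointLaw_fst : (jointLaw ρ π).fst = inputLaw ρ := by
  have h : (fun x => ∫⁻ y, ENNReal.ofReal (ρ.state x * π.effect y).trace.re) =
      fun x => ENNReal.ofReal (ρ.state x).trace.re :=
    funext fun x => π.lintegral_trace_mul (ρ.posSemidef x)
  rw [inputLaw, ← h]
  exact fst_prod_withDensity volume volume (measurable_bornDensity ρ π).ennreal_ofReal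

instance : IsProbabilityMeasure (jointLaw ρ π) := by
  refine ⟨?_⟩
  rw [← Measure.fst_univ, jointLaw_fst, measure_univ]

/-- The overlap of the normalized state with the normalized effect. -/
noncomputable def overlap (z : ℝ × ℝ) : ℝ :=
  (ρ.state z.1 * π.effect z.2).trace.re / ((ρ.state z.1).trace.re * (π.effect z.2).trace.re)

theorem measurable_overlap : Measurable (overlap ρ π) :=
  (measurable_bornDensity ρ π).div ((ρ.measurable_trace_re.comp measurable_fst).mul
    (π.measurable_trace_re.comp measurable_snd))

theorem overlap_nonneg (z : ℝ × ℝ) : 0 ≤ overlap ρ π z :=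
  div_nonneg ((ρ.posSemidef _).trace_mul_re_nonneg (π.posSemidef _))
    (mul_nonneg (ρ.posSemidef _).trace_re_nonneg (π.posSemidef _).trace_re_nonneg)

theorem overlap_le_one (z : ℝ × ℝ) : overlap ρ π z ≤ 1 :=
  div_le_one_of_le₀ ((ρ.posSemidef _).trace_mul_re_le (π.posSemidef _))
    (mul_nonneg (ρ.posSemidef _).trace_re_nonneg (π.posSemidef _).trace_re_nonneg)

theorem jointLaw_eq_withDensity (hd : 1 ≤ d) :
    jointLaw ρ π = ((inputLaw ρ).prod (uniformOutcomeLaw π)).withDensity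
      fun z => ENNReal.ofReal (d * overlap ρ π z) := by
  have hd0 : (d : ℝ) ≠ 0 := by exact_mod_cast (by omega : d ≠ 0)
  have h1 := ρ.measurable_trace_re.ennreal_ofReal
  have h2 := (π.measurable_trace_re.div_const (d : ℝ)).ennreal_ofReal
  have h12 : Measurable fun z : ℝ × ℝ => ENNReal.ofReal (ρ.state z.1).trace.re *
      ENNReal.ofReal ((π.effect z.2).trace.re / d) :=
    (h1.comp measurable_fst).mul (h2.comp measurable_snd)
  rw [inputLaw, uniformOutcomeLaw, prod_withDensity h1 h2, ← withDensity_mul _ h12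
    ((measurable_overlap ρ π).const_mul (d : ℝ)).ennreal_ofReal, jointLaw, Measure.volume_eq_prod]
  congr 1
  funext z
  have ha := (ρ.posSemidef z.1).trace_re_nonneg
  have hb := (π.posSemidef z.2).trace_re_nonneg
  simp only [Pi.mul_apply]
  rw [← ENNReal.ofReal_mul ha, ← ENNReal.ofReal_mul (by positivity)]
  congr 1
  rw [overlap]
  by_cases h : (ρ.state z.1).trace.re * (π.effect z.2).trace.re = 0
  -- Here `overlap` is `0` through division by zero, and the Born density is squeezed to `0` too.
  · have h3 := (ρ.posSemidef z.1).trace_mul_re_le (π.posSemidef z.2)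
    have h4 := (ρ.posSemidef z.1).trace_mul_re_nonneg (π.posSemidef z.2)
    rw [h] at h3 ⊢
    rw [le_antisymm h3 h4]; simp
  · rw [show ∀ a b c : ℝ, a * (b / d) * (d * (c / (a * b))) = a * b * (c / (a * b)) * (d / d) from
      fun a b c => by ring, div_self hd0, mul_one, mul_div_cancel₀ _ h]

theorem integrable_negMulLog_overlap (μ : Measure (ℝ × ℝ)) [IsFiniteMeasure μ] :
    Integrable (fun z => Real.negMulLog (overlap ρ π z)) μ := by
  refine (integrable_const (1 : ℝ)).mono' (Real.continuous_negMulLog.measurable.comp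
    (measurable_overlap ρ π)).aestronglyMeasurable (.of_forall fun z => ?_)
  rw [Real.norm_of_nonneg (Real.negMulLog_nonneg (overlap_nonneg ρ π z) (overlap_le_one ρ π z))]
  exact (Real.negMulLog_le_one_sub_self (overlap_nonneg ρ π z)).trans
    (sub_le_self _ (overlap_nonneg ρ π z))

/-- The reference law `uniformOutcomeLaw` depends on `π` alone, which makes the density exactly `d *
overlap`. -/
theorem mutualInformation_le (hd : 1 ≤ d) : mutualInformation ρ π ≤ ENNReal.ofReal (Real.log d -
    d * ∫ z, Real.negMulLog (overlap ρ π z) ∂(inputLaw ρ).prod (uniformOutcomeLaw π)) := by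
  have := isProbabilityMeasure_uniformOutcomeLaw π hd
  have hd0 : (0 : ℝ) < d := by exact_mod_cast hd
  refine (klDiv_fst_prod_snd_le (jointLaw ρ π) (uniformOutcomeLaw π)).trans ?_
  have hP : IsProbabilityMeasure (jointLaw ρ π) := inferInstance
  rw [jointLaw_fst]
  rw [jointLaw_eq_withDensity ρ π hd] at hP ⊢
  exact (klDiv_withDensity_mul_eq _ hd0 (measurable_overlap ρ π) (overlap_nonneg ρ π)
    (overlap_le_one ρ π)).le

theorem integral_inputLaw (f : ℝ → ℝ) :
    ∫ x, f x ∂inputLaw ρ = ∫ x, (ρ.state x).trace.re * f x := by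
  rw [inputLaw, integral_withDensity_eq_integral_toReal_smul
    ρ.measurable_trace_re.ennreal_ofReal (.of_forall fun _ => ENNReal.ofReal_lt_top)]
  refine integral_congr_ae (.of_forall fun x => ?_)
  simp only [ENNReal.toReal_ofReal (ρ.posSemidef x).trace_re_nonneg, smul_eq_mul]

theorem integral_uniformOutcomeLaw (f : ℝ → ℝ) :
    ∫ y, f y ∂uniformOutcomeLaw π = ∫ y, (π.effect y).trace.re / d * f y := by
  rw [uniformOutcomeLaw, integral_withDensity_eq_integral_toReal_smul
    (π.measurable_trace_re.div_const (d : ℝ)).ennreal_ofReal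
    (.of_forall fun _ => ENNReal.ofReal_lt_top)]
  refine integral_congr_ae (.of_forall fun y => ?_)
  simp only [ENNReal.toReal_ofReal (div_nonneg (π.posSemidef y).trace_re_nonneg
    (Nat.cast_nonneg d)), smul_eq_mul]

theorem ae_inputLaw_trace_pos : ∀ᵐ x ∂inputLaw ρ, 0 < (ρ.state x).trace.re := by
  rw [inputLaw, ae_withDensity_iff ρ.measurable_trace_re.ennreal_ofReal]
  exact .of_forall fun x h => by simpa using h

theorem ae_uniformOutcomeLaw_trace_pos :
    ∀ᵐ y ∂uniformOutcomeLaw π, 0 < (π.effect y).trace.re := by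
  rw [uniformOutcomeLaw, ae_withDensity_iff (π.measurable_trace_re.div_const (d : ℝ)).ennreal_ofReal]
  refine .of_forall fun y h => ?_
  by_contra hn
  exact h (ENNReal.ofReal_of_nonpos (div_nonpos_of_nonpos_of_nonneg (not_lt.1 hn)
    (Nat.cast_nonneg d)))

end Laws

theorem Matrix.PosSemidef.normalize {d : ℕ} {M : Matrix (Fin d) (Fin d) ℂ} (hM : M.PosSemidef)
    (hpos : 0 < M.trace.re) : ((M.trace.re⁻¹ : ℝ) • M).PosSemidef ∧
      ((M.trace.re⁻¹ : ℝ) • M).trace.re = 1 := by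
  refine ⟨hM.smul (inv_nonneg.2 hpos.le), ?_⟩
  rw [Matrix.trace_smul, Complex.real_smul, Complex.re_ofReal_mul, inv_mul_cancel₀ hpos.ne']

/-! ### Bounds for design POVMs and design ensembles -/

section Bounds

variable {d t : ℕ} {p : Polynomial ℝ}

/-- The bound of the theorem is nonnegative as soon as a normalized design exists. -/
theorem IsSphericalDesign.sum_coeff_le_log_div (hd : 1 ≤ d) {A : ℝ → Matrix (Fin d) (Fin d) ℂ}
    (hm : ∀ i j, Measurable fun y => A y i j)
    (hpsd : ∀ y, (A y).PosSemidef) (h1 : ∫ y, (A y).trace.re = 1)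
    (hdes : IsSphericalDesign t A) (hp : p.natDegree ≤ t)
    (hp0 : p.coeff 0 = 0) (hpη : ∀ s, 0 ≤ s → s ≤ 1 → p.eval s ≤ Real.negMulLog s) :
    0 ≤ Real.log d - d * ∑ k ∈ Finset.Icc 1 t,
      p.coeff k * ((Nat.choose (d + k - 1) k : ℕ) : ℝ)⁻¹ := by
  have hd0 : (0 : ℝ) < d := by exact_mod_cast hd
  have hint : Integrable fun y => (A y).trace.re :=
    Integrable.of_integral_ne_zero (by rw [h1]; exact one_ne_zero)
  have htr : (1 : Matrix (Fin d) (Fin d) ℂ).trace.re = d := by simp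
  obtain ⟨hσ, hσ1⟩ := (Matrix.PosSemidef.one (n := Fin d) (R := ℂ)).normalize (by rw [htr]; exact hd0)
  have h := hdes.sum_coeff_le_integral_negMulLog hd hm hpsd hint hp hp0 hpη hσ hσ1
  -- For the maximally mixed `σ` the overlap is `1 / d` wherever the trace is nonzero, and `d * η(1
  -- / d) = ln d`.
  have heq : ∀ y, (A y).trace.re * Real.negMulLog
      ((((1 : Matrix (Fin d) (Fin d) ℂ).trace.re⁻¹ : ℝ) • (1 : Matrix (Fin d) (Fin d) ℂ) *
        A y).trace.re / (A y).trace.re) = (A y).trace.re * ((d : ℝ)⁻¹ * Real.log d) := by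
    intro y
    by_cases h0 : (A y).trace.re = 0
    · simp [h0]
    · rw [htr, Matrix.smul_mul, Matrix.one_mul, Matrix.trace_smul, Complex.real_smul,
        Complex.re_ofReal_mul, mul_div_assoc, div_self h0, mul_one, Real.negMulLog, Real.log_inv]
      ring
  simp_rw [heq] at h
  rw [integral_mul_const, h1, one_mul] at h
  have := mul_le_mul_of_nonneg_left h hd0.le
  rw [mul_inv_cancel_left₀ hd0.ne'] at this
  linarith

theorem POVM.scaled_trace_re (π : POVM d) (y : ℝ) :
    (((d : ℂ)⁻¹) • π.effect y).trace.re = (π.effect y).trace.re / d := by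
  rw [Matrix.trace_smul, smul_eq_mul, ← Complex.ofReal_natCast, ← Complex.ofReal_inv,
    Complex.re_ofReal_mul, div_eq_inv_mul]

theorem POVM.scaled_posSemidef (π : POVM d) (y : ℝ) : (((d : ℂ)⁻¹) • π.effect y).PosSemidef := by
  refine (π.posSemidef y).smul ?_
  rw [← Complex.ofReal_natCast, ← Complex.ofReal_inv]
  exact_mod_cast inv_nonneg.2 (Nat.cast_nonneg (α := ℝ) d)

/-- For almost every input the design estimate applies with the normalized state as `σ`; its bound
does not depend on the input, so it survives averaging. -/
theorem POVM.IsDesign.sum_coeff_le_integral (hd : 1 ≤ d) {π : POVM d} (hπ : π.IsDesign t)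
    (hp : p.natDegree ≤ t) (hp0 : p.coeff 0 = 0)
    (hpη : ∀ s, 0 ≤ s → s ≤ 1 → p.eval s ≤ Real.negMulLog s) (ρ : Ensemble d) :
    ∑ k ∈ Finset.Icc 1 t, p.coeff k * ((Nat.choose (d + k - 1) k : ℕ) : ℝ)⁻¹ ≤
      ∫ z, Real.negMulLog (overlap ρ π z) ∂(inputLaw ρ).prod (uniformOutcomeLaw π) := by
  have hd0 : (d : ℝ) ≠ 0 := by exact_mod_cast (by omega : d ≠ 0)
  have := isProbabilityMeasure_uniformOutcomeLaw π hd
  have hi := integrable_negMulLog_overlap ρ π ((inputLaw ρ).prod (uniformOutcomeLaw π))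
  rw [integral_prod _ hi]
  have hconst := integral_const (μ := inputLaw ρ) (∑ k ∈ Finset.Icc 1 t,
    p.coeff k * ((Nat.choose (d + k - 1) k : ℕ) : ℝ)⁻¹)
  rw [probReal_univ, one_smul] at hconst
  rw [← hconst]
  refine integral_mono_ae (integrable_const _) hi.integral_prod_left ?_
  filter_upwards [ae_inputLaw_trace_pos ρ] with x hx
  obtain ⟨hσ, hσ1⟩ := (ρ.posSemidef x).normalize hx
  have h := IsSphericalDesign.sum_coeff_le_integral_negMulLog hd
    (A := fun y => ((d : ℂ)⁻¹) • π.effect y)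
    (fun i j => (π.measurable_entry i j).const_mul _) π.scaled_posSemidef
    (by simp_rw [π.scaled_trace_re]; exact π.integrable_trace.div_const _) hπ hp hp0 hpη hσ hσ1
  refine h.trans_eq ?_
  rw [integral_uniformOutcomeLaw]
  refine integral_congr_ae (.of_forall fun y => ?_)
  simp only [π.scaled_trace_re]
  by_cases h0 : (π.effect y).trace.re = 0
  · simp [h0]
  · congr 2
    rw [Matrix.smul_mul, Matrix.mul_smul, Matrix.trace_smul, Matrix.trace_smul, smul_eq_mul,
      Complex.real_smul, Complex.re_ofReal_mul, ← Complex.ofReal_natCast, ← Complex.ofReal_inv,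
      Complex.re_ofReal_mul, overlap]
    field_simp

/-- The roles are exchanged: the outcome is fixed first, its normalized effect serves as `σ`, and
the trace is cyclic. -/
theorem Ensemble.IsDesign.sum_coeff_le_integral (hd : 1 ≤ d) {ρ : Ensemble d} (hρ : ρ.IsDesign t)
    (hp : p.natDegree ≤ t) (hp0 : p.coeff 0 = 0)
    (hpη : ∀ s, 0 ≤ s → s ≤ 1 → p.eval s ≤ Real.negMulLog s) (π : POVM d) :
    ∑ k ∈ Finset.Icc 1 t, p.coeff k * ((Nat.choose (d + k - 1) k : ℕ) : ℝ)⁻¹ ≤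
      ∫ z, Real.negMulLog (overlap ρ π z) ∂(inputLaw ρ).prod (uniformOutcomeLaw π) := by
  have := isProbabilityMeasure_uniformOutcomeLaw π hd
  have hi := integrable_negMulLog_overlap ρ π ((inputLaw ρ).prod (uniformOutcomeLaw π))
  rw [integral_prod_symm _ hi]
  have hconst := integral_const (μ := uniformOutcomeLaw π) (∑ k ∈ Finset.Icc 1 t,
    p.coeff k * ((Nat.choose (d + k - 1) k : ℕ) : ℝ)⁻¹)
  rw [probReal_univ, one_smul] at hconst
  rw [← hconst]
  refine integral_mono_ae (integrable_const _) hi.integral_prod_right ?_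
  filter_upwards [ae_uniformOutcomeLaw_trace_pos π] with y hy
  obtain ⟨hσ, hσ1⟩ := (π.posSemidef y).normalize hy
  have h := IsSphericalDesign.sum_coeff_le_integral_negMulLog hd
    ρ.measurable_entry ρ.posSemidef ρ.integrable_trace hρ hp hp0 hpη hσ hσ1
  refine h.trans_eq ?_
  rw [integral_inputLaw]
  refine integral_congr_ae (.of_forall fun x => ?_)
  dsimp only
  congr 2
  rw [Matrix.smul_mul, Matrix.trace_smul, Complex.real_smul, Complex.re_ofReal_mul, overlap,
    Matrix.trace_mul_comm, ← div_eq_inv_mul, div_div, mul_comm (π.effect y).trace.re]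

end Bounds

theorem EReal.coe_ennreal_le_coe_of_le_ofReal {a : ℝ≥0∞} {b : ℝ} (hb : 0 ≤ b)
    (h : a ≤ ENNReal.ofReal b) : (a : EReal) ≤ (b : EReal) := by
  refine (EReal.coe_ennreal_le_coe_ennreal_iff.2 h).trans_eq ?_
  rw [EReal.coe_ennreal_ofReal, max_eq_left hb]

theorem mainTheorem1 (d t : ℕ) (hd : 1 ≤ d) (ht : 1 ≤ t)
    (x : Fin (t / 2) → ℝ) (hx : StrictMono x) (hx01 : ∀ i, 0 < x i ∧ x i < 1) :
    (∃! p : Polynomial ℝ, IsEtaInterpolant t x p) ∧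
    ∀ p : Polynomial ℝ, IsEtaInterpolant t x p →
      (∀ π : POVM d, π.IsDesign t →
        (π.informationalPower : EReal) ≤
          ((Real.log d - d * ∑ k ∈ Finset.Icc 1 t,
            p.coeff k * ((Nat.choose (d + k - 1) k : ℕ) : ℝ)⁻¹ : ℝ) : EReal)) ∧
      (∀ ρ : Ensemble d, ρ.IsDesign t →
        (ρ.accessibleInformation : EReal) ≤
          ((Real.log d - d * ∑ k ∈ Finset.Icc 1 t,
            p.coeff k * ((Nat.choose (d + k - 1) k : ℕ) : ℝ)⁻¹ : ℝ) : EReal)) := by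
  refine ⟨existsUnique_isEtaInterpolant hx hx01, fun p hp => ?_⟩
  have hd0 : (d : ℝ) ≠ 0 := by exact_mod_cast (by omega : d ≠ 0)
  have hη : ∀ s, 0 ≤ s → s ≤ 1 → p.eval s ≤ Real.negMulLog s := fun s h0 h1 =>
    hp.eval_le_negMulLog ht hx hx01 h0 h1
  have hmono : ∀ {a b : ℝ}, a ≤ b → ENNReal.ofReal (Real.log d - d * b) ≤
      ENNReal.ofReal (Real.log d - d * a) := fun h =>
    ENNReal.ofReal_le_ofReal (sub_le_sub_left (mul_le_mul_of_nonneg_left h (Nat.cast_nonneg d)) _)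
  refine ⟨fun π hπ => ?_, fun ρ hρ => ?_⟩
  -- `ENNReal.ofReal` truncates at `0`, so the bound as a real number also needs its nonnegativity,
  -- which the design itself provides.
  · refine EReal.coe_ennreal_le_coe_of_le_ofReal ?_ (iSup_le fun ρ =>
      (mutualInformation_le ρ π hd).trans
        (hmono (hπ.sum_coeff_le_integral hd hp.natDegree_le hp.coeff_zero hη ρ)))
    refine IsSphericalDesign.sum_coeff_le_log_div hd (A := fun y => ((d : ℂ)⁻¹) • π.effect y)
      (fun i j => (π.measurable_entry i j).const_mul _) π.scaled_posSemidef ?_ hπ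
      hp.natDegree_le hp.coeff_zero hη
    rw [integral_congr_ae (.of_forall π.scaled_trace_re), integral_div, π.integral_trace, div_self hd0]
  · exact EReal.coe_ennreal_le_coe_of_le_ofReal
      (IsSphericalDesign.sum_coeff_le_log_div hd ρ.measurable_entry ρ.posSemidef ρ.integral_trace
        hρ hp.natDegree_le hp.coeff_zero hη)
      (iSup_le fun π => (mutualInformation_le ρ π hd).trans
        (hmono (hρ.sum_coeff_le_integral hd hp.natDegree_le hp.coeff_zero hη π)))
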